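/- Let $d\in\mathbb N$ and $\beta>0$, let $d<s<2d$, and write $\|x\|=\sum_k|x_k|$ for $x\in\mathbb R^d$. **Model.** For $N\in\mathbb N$ put $Z_N=(N+1)^d$ and let $X_0,\dots,X_{Z_N-1}$ be an enumeration, without repetition, of $[0,N]^d\cap\mathbb Z^d$ with $X_0=0$ and $\|X_{i+1}-X_i\|=1$ for $0\le i\le Z_N-2$. For $\rho>0$ let $\mathcal P$ be a homogeneous Poisson point process of intensity $\rho$ on $[0,N]^d$: the number of points in a Borel set $B\subseteq[0,N]^d$ is Poisson distributed with parameter $\rho|B|$, and the numbers of points in finitely many pairwise disjoint Borel subsets of $[0,N]^d$ are independent. Let $G(N)$ be the random graph with vertex set $\{X_0,\dots,X_{Z_N-1}\}\cup\mathcal P$ in which the pairs $\{X_i,X_{i+1}\}$, $0\le i\le Z_N-2$, are always joined by an edge and, given $\mathcal P$, every other pair $\{x,y\}$ of distinct vertices is joined independently with probability $g(x-y)=1-\exp(-\beta\|x-y\|^{-s})$. (Equivalently, the pair is joined if and only if $U_{x,y}\le g(x-y)$, where the $U_{x,y}$ are independent, uniform on $[0,1]$ and independent of $\mathcal P$.)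 Let $C(0)$ be the connected component of the origin $X_0$ in $G(N)$, and let $D(N)=\max_{x,y\in C(0)}d_{G(N)}(x,y)$ be its diameter in the graph distance. **Statement.** For every constant $C>0$ there is a constant $\delta>1$, depending only on $C,d,s,\beta$, such that for every $\rho>0$ there is an $N_0$ such that, for all $N\ge N_0$ and every enumeration $X_0,\dots,X_{Z_N-1}$ as above, $$P\big(D(N)>(\log N)^\delta\big)\le C\exp\big(-C(\log N)^C\big).$$ -/

import Mathlib

open MeasureTheory ProbabilityTheory
open scoped ENNReal NNReal

noncomputable section

namespace RCM

/-- The `1`-norm on `ℝ^d`. -/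
def oneNorm {d : ℕ} (x : Fin d → ℝ) : ℝ := ∑ k, |x k|

/-- The cube `[0,N]^d` in `ℝ^d`. -/
def cube (d N : ℕ) : Set (Fin d → ℝ) := Set.Icc 0 (fun _ => (N : ℝ))

/-- The lattice cube `Z = [0,N]^d ∩ ℤ^d`. -/
def latticeCube (d N : ℕ) : Set (Fin d → ℤ) := Set.Icc 0 (fun _ => (N : ℤ))

/-- The number `Z_N = (N+1)^d` of elements of the lattice cube. -/
def latticeCard (d N : ℕ) : ℕ := (N + 1) ^ d

/-- `X_0, …, X_{Z_N - 1}` lists every point of the lattice cube exactly once, starts at the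
origin, and consecutive points are at `1`-distance `1`. (Values `X i` with `i ≥ Z_N` are not
used.) -/
structure IsBackbone (d N : ℕ) (X : ℕ → Fin d → ℤ) : Prop where
  bijOn : Set.BijOn X (Set.Iio (latticeCard d N)) (latticeCube d N)
  start : X 0 = 0
  step : ∀ i, i + 1 < latticeCard d N → ∑ k, |X (i + 1) k - X i k| = 1

open Classical in
/-- The number of points in `B` of the finite point configuration `Y 0, …, Y (K - 1)`. -/
def pointCount {d : ℕ} (K : ℕ) (Y : ℕ → Fin d → ℝ) (B : Set (Fin d → ℝ)) : ℕ :=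
  ((Finset.range K).filter (fun i => Y i ∈ B)).card

/-- The random points `Y 0, …, Y (K - 1)` (with a random number `K` of points) form a homogeneous
Poisson point process of intensity `ρ` on the window `W`: they lie in `W`, the number of points
in a Borel set `B ⊆ W` is Poisson distributed with parameter `ρ |B|`, and the numbers of points in
finitely many pairwise disjoint Borel subsets of `W` are independent. -/
structure IsPoissonProcess {d : ℕ} {Ω : Type*} [MeasurableSpace Ω] (P : Measure Ω)
    (ρ : ℝ) (W : Set (Fin d → ℝ)) (K : Ω → ℕ) (Y : ℕ → Ω → Fin d → ℝ) : Prop where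
  measurable_card : Measurable K
  measurable_point : ∀ i, Measurable (Y i)
  mem_window : ∀ ω i, i < K ω → Y i ω ∈ W
  poisson : ∀ B ⊆ W, MeasurableSet B →
    P.map (fun ω => pointCount (K ω) (fun i => Y i ω) B)
      = poissonMeasure (ρ.toNNReal * (volume B).toNNReal)
  indep : ∀ (n : ℕ) (B : Fin n → Set (Fin d → ℝ)), (∀ k, B k ⊆ W) → (∀ k, MeasurableSet (B k)) →
    Pairwise (fun k l => Disjoint (B k) (B l)) →
    iIndepFun (fun k ω => pointCount (K ω) (fun i => Y i ω) (B k)) P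

/-- The family `U`, indexed by unordered pairs of labels, is an independent family of random
variables that are uniformly distributed on `[0,1]`. -/
structure IsUniformMarks {Ω : Type*} [MeasurableSpace Ω] (P : Measure Ω)
    (U : Sym2 ℕ → Ω → ℝ) : Prop where
  measurable_mark : ∀ e, Measurable (U e)
  uniform : ∀ e, P.map (U e) = volume.restrict (Set.Icc (0 : ℝ) 1)
  indep : iIndepFun U P

/-- The randomness behind the graph `G(N)`: a Poisson point process of intensity `ρ` on `[0,N]^d`
and, independently of it, independent uniform marks on the unordered pairs of vertex labels. -/
structure IsModel (d N : ℕ) {Ω : Type*} [MeasurableSpace Ω] (P : Measure Ω)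
    (ρ : ℝ) (K : Ω → ℕ) (Y : ℕ → Ω → Fin d → ℝ) (U : Sym2 ℕ → Ω → ℝ) : Prop where
  points : IsPoissonProcess P ρ (cube d N) K Y
  marks : IsUniformMarks P U
  indep : IndepFun (fun ω => (K ω, fun i => Y i ω)) (fun ω e => U e ω) P

/-- The connection function `g(x) = 1 - exp(-β ‖x‖^{-s})`. -/
def connProb {d : ℕ} (β s : ℝ) (x : Fin d → ℝ) : ℝ :=
  1 - Real.exp (-β * oneNorm x ^ (-s))

/-- The position of the vertex with label `i`: the backbone points `X_0, …, X_{Z_N - 1}` come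
first, and they are followed by the Poisson points. -/
def position (d N : ℕ) (X : ℕ → Fin d → ℤ) (Y : ℕ → Fin d → ℝ) (i : ℕ) : Fin d → ℝ :=
  if i < latticeCard d N then (fun k => (X i k : ℝ)) else Y (i - latticeCard d N)

/-- One realization of the graph `G(N)`. Its vertices are the labels `i < Z_N + K`; labels beyond
that are no vertices and carry no edge. Consecutive backbone points are always joined. Any other
pair `{i, j}` of vertices is joined if and only if its mark is at most `g` of the difference of
the positions. -/
def graph (d N : ℕ) (β s : ℝ) (X : ℕ → Fin d → ℤ) (K : ℕ) (Y : ℕ → Fin d → ℝ)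
    (U : Sym2 ℕ → ℝ) : SimpleGraph ℕ :=
  SimpleGraph.fromRel (fun i j =>
    i < j ∧ j < latticeCard d N + K ∧
      ((j = i + 1 ∧ j < latticeCard d N) ∨
        U s(i, j) ≤ connProb β s (position d N X Y i - position d N X Y j)))

/-- The diameter of the cluster of the vertex `v` in `G`: the supremum of the graph distances
between vertices that are connected to `v`. -/
def clusterDiam {V : Type*} (G : SimpleGraph V) (v : V) : ℕ∞ :=
  ⨆ (x : V) (_ : G.Reachable v x) (y : V) (_ : G.Reachable v y), G.edist x y

end RCM

end

/-! Write x = log N, and let r and R₀ be of order x^a and x^b. Outside three unlikely events the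
diameter is deterministically at most a power of x.

Lattice neighbours are close (`IsBackbone.measure_exists_far_neighbours_le`). For d ≥ 2 the sup-norm
spheres of radius 1, …, r around a site are connected by unit pairs, each open with probability 1 -
e^{-β}, and the backbone leads from every point of one sphere to the next larger one. The number of
components meeting a sphere is a supermodular function of the set of open pairs, so opening the
pairs of one sphere multiplies the bound on the mean excess over one component by e^{-β}. After r
spheres the excess is at most (2r+1)^d e^{-βr} in mean, and Markov's inequality makes the innermost
sphere connected inside a ball of at most (2r+1)^d sites. For d = 1 the backbone is already the
lattice path.

Distant sites are linked (`IsBackbone.measure_exists_no_long_edge_le`). As s < 2d, some γ < 1 has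
2dγ > s. Boxes of side about R^γ near two sites at distance R span at least R^{2dγ} pairs, each
closed with probability at most exp(-const R^{-s}), so all are closed with stretched exponentially
small probability. Iterating the link k times (`IsBackbone.edist_add_one_le`) brings distances from
R to R^{γ^k} at the price of 2^k pieces. From R ≤ N a bounded scale is reached with k of order log
log N, so 2^k is a power of log N.

Poisson points are close to the backbone (`IsBackbone.measure_exists_far_from_backbone_le`). A
Poisson point of the cluster that is far from the backbone starts a path through many Poisson
points, each of which has a fresh chance, bounded below, to be joined to a nearby lattice site. The
mean number of Poisson points is ρN^d.

All three probabilities are at most a constant times e^{4dx - c x^a}, and a > max(C, 1) makes this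
smaller than the required bound. The intensity ρ enters only as a prefactor, so it affects N₀ but
not δ. -/

namespace RCM

/-! ### Components meeting a finite set: monotonicity and supermodularity -/

section ClusterCount

variable {V : Type*}

open Classical in
/-- The number of connected components of `G` that meet `S`. -/
noncomputable def clusterCount (G : SimpleGraph V) (S : Finset V) : ℕ :=
  (S.image G.connectedComponentMk).card

lemma clusterCount_mono {G H : SimpleGraph V} (h : G ≤ H) (S : Finset V) :
    clusterCount H S ≤ clusterCount G S := by
  classical
  refine Finset.card_le_card_of_surjOn (SimpleGraph.ConnectedComponent.map (.ofLE h)) ?_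
  intro c hc
  simp only [Finset.coe_image, Set.mem_image, Finset.mem_coe] at hc ⊢
  obtain ⟨v, hv, rfl⟩ := hc
  exact ⟨_, ⟨v, hv, rfl⟩, rfl⟩

lemma clusterCount_le_of_reachable {G : SimpleGraph V} {S T : Finset V}
    (h : ∀ z ∈ S, ∃ w ∈ T, G.Reachable z w) : clusterCount G S ≤ clusterCount G T := by
  classical
  refine Finset.card_le_card fun c hc => ?_
  obtain ⟨z, hz, rfl⟩ := Finset.mem_image.1 hc
  obtain ⟨w, hw, hzw⟩ := h z hz
  exact Finset.mem_image.2 ⟨w, hw, (SimpleGraph.ConnectedComponent.eq.2 hzw).symm⟩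

lemma clusterCount_le_one_iff {G : SimpleGraph V} {S : Finset V} :
    clusterCount G S ≤ 1 ↔ ∀ a ∈ S, ∀ b ∈ S, G.Reachable a b := by
  rw [clusterCount, Finset.card_le_one]
  simp [SimpleGraph.ConnectedComponent.eq]

lemma clusterCount_le_card (G : SimpleGraph V) (S : Finset V) : clusterCount G S ≤ S.card :=
  by classical exact Finset.card_image_le

lemma clusterCount_pos (G : SimpleGraph V) {S : Finset V} {v : V} (hv : v ∈ S) :
    0 < clusterCount G S := by
  classical exact Finset.card_pos.2 ⟨_, Finset.mem_image_of_mem _ hv⟩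

/-- The old components other than that of `b` already map onto all new ones, because the new edge
merges the component of `b` into that of `a`. -/
lemma clusterCount_sup_edge_add_one_le {G : SimpleGraph V} {S : Finset V} {a b : V} (ha : a ∈ S)
    (hb : b ∈ S) (h : ¬ G.Reachable a b) :
    clusterCount (G ⊔ SimpleGraph.edge a b) S + 1 ≤ clusterCount G S := by
  classical
  have hab : a ≠ b := by rintro rfl; exact h .rfl
  have hmem : G.connectedComponentMk b ∈ S.image G.connectedComponentMk :=
    Finset.mem_image_of_mem _ hb
  have key : clusterCount (G ⊔ SimpleGraph.edge a b) S ≤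
      ((S.image G.connectedComponentMk).erase (G.connectedComponentMk b)).card := by
    refine Finset.card_le_card_of_surjOn (SimpleGraph.ConnectedComponent.map (.ofLE le_sup_left)) ?_
    intro c hc
    simp only [Finset.coe_image, Set.mem_image, Finset.mem_coe] at hc
    obtain ⟨v, hv, rfl⟩ := hc
    by_cases hvb : G.Reachable v b
    · refine ⟨G.connectedComponentMk a, ?_, ?_⟩
      · simp only [Finset.coe_erase, Finset.coe_image, Set.mem_sdiff, Set.mem_image, Finset.mem_coe,
          Set.mem_singleton_iff, SimpleGraph.ConnectedComponent.eq]
        exact ⟨⟨a, ha, .rfl⟩, h⟩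
      · refine SimpleGraph.ConnectedComponent.eq.2 ?_
        refine SimpleGraph.Reachable.trans (v := b) ?_ (hvb.mono le_sup_left).symm
        refine SimpleGraph.Adj.reachable ?_
        simp [SimpleGraph.sup_adj, SimpleGraph.edge_adj, hab]
    · refine ⟨G.connectedComponentMk v, ?_, rfl⟩
      simp only [Finset.coe_erase, Finset.coe_image, Set.mem_sdiff, Set.mem_image, Finset.mem_coe,
          Set.mem_singleton_iff, SimpleGraph.ConnectedComponent.eq]
      exact ⟨⟨v, hv, .rfl⟩, hvb⟩
  rw [Finset.card_erase_of_mem hmem] at key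
  have : 0 < (S.image G.connectedComponentMk).card := Finset.card_pos.2 ⟨_, hmem⟩
  rw [clusterCount] at *
  unfold clusterCount
  omega

/-- A labelling that is constant along the edges is constant on components. -/
lemma eq_of_reachable_of_forall_adj {α : Type*} {G : SimpleGraph V} (f : V → α)
    (h : ∀ u v, G.Adj u v → f u = f v) {u v : V} (huv : G.Reachable u v) : f u = f v := by
  obtain ⟨w⟩ := huv
  induction w with
  | nil => rfl
  | cons hadj _ ih => exact (h _ _ hadj).trans ih

/-- Relabelling the component of `b` by that of `a` gives a labelling `f` that is constant along the
enlarged graph. It therefore takes at most as many values on `S` as there are new components, and it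
loses only the label of `b`. -/
lemma clusterCount_le_sup_edge_add_one (G : SimpleGraph V) (S : Finset V) (a b : V) :
    clusterCount G S ≤ clusterCount (G ⊔ SimpleGraph.edge a b) S + 1 := by
  classical
  let f : V → G.ConnectedComponent := fun v =>
    if G.connectedComponentMk v = G.connectedComponentMk b then G.connectedComponentMk a
    else G.connectedComponentMk v
  have hf : ∀ u v, (G ⊔ SimpleGraph.edge a b).Adj u v → f u = f v := by
    intro u v huv
    rw [SimpleGraph.sup_adj] at huv
    rcases huv with huv | huv
    · have : G.connectedComponentMk u = G.connectedComponentMk v :=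
        SimpleGraph.ConnectedComponent.eq.2 huv.reachable
      simp only [f, this]
    · rw [SimpleGraph.edge_adj] at huv
      rcases huv.1 with ⟨rfl, rfl⟩ | ⟨rfl, rfl⟩ <;> simp [f]
  have hsub : S.image G.connectedComponentMk ⊆
      insert (G.connectedComponentMk b) (S.image f) := by
    intro c hc
    obtain ⟨v, hv, rfl⟩ := Finset.mem_image.1 hc
    by_cases hvb : G.connectedComponentMk v = G.connectedComponentMk b
    · rw [hvb]; exact Finset.mem_insert_self _ _
    · refine Finset.mem_insert_of_mem (Finset.mem_image.2 ⟨v, hv, ?_⟩)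
      simp only [f, if_neg hvb]
  have hcard : (S.image f).card ≤ clusterCount (G ⊔ SimpleGraph.edge a b) S := by
    let g : (G ⊔ SimpleGraph.edge a b).ConnectedComponent → G.ConnectedComponent :=
      Quot.lift f fun u v huv => eq_of_reachable_of_forall_adj f hf huv
    refine Finset.card_le_card_of_surjOn g ?_
    intro c hc
    simp only [Finset.coe_image, Set.mem_image, Finset.mem_coe] at hc ⊢
    obtain ⟨v, hv, rfl⟩ := hc
    exact ⟨_, ⟨v, hv, rfl⟩, rfl⟩
  calc clusterCount G S ≤ _ := Finset.card_le_card hsub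
    _ ≤ (S.image f).card + 1 := Finset.card_insert_le _ _
    _ ≤ _ := by omega

lemma clusterCount_sup_edge_eq {G : SimpleGraph V} {a b : V} (h : G.Reachable a b)
    (S : Finset V) : clusterCount G S = clusterCount (G ⊔ SimpleGraph.edge a b) S := by
  classical
  refine le_antisymm ?_ (clusterCount_mono le_sup_left S)
  have hf : ∀ u v, (G ⊔ SimpleGraph.edge a b).Adj u v →
      G.connectedComponentMk u = G.connectedComponentMk v := by
    intro u v huv
    rw [SimpleGraph.sup_adj] at huv
    rcases huv with huv | huv
    · exact SimpleGraph.ConnectedComponent.eq.2 huv.reachable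
    · rw [SimpleGraph.edge_adj] at huv
      rcases huv.1 with ⟨rfl, rfl⟩ | ⟨rfl, rfl⟩
      · exact SimpleGraph.ConnectedComponent.eq.2 h
      · exact SimpleGraph.ConnectedComponent.eq.2 h.symm
  let g : (G ⊔ SimpleGraph.edge a b).ConnectedComponent → G.ConnectedComponent :=
    Quot.lift G.connectedComponentMk fun u v huv => eq_of_reachable_of_forall_adj _ hf huv
  refine Finset.card_le_card_of_surjOn g ?_
  intro c hc
  simp only [Finset.coe_image, Set.mem_image, Finset.mem_coe] at hc ⊢
  obtain ⟨v, hv, rfl⟩ := hc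
  exact ⟨_, ⟨v, hv, rfl⟩, rfl⟩

/-- Adding an edge inside `S` to a larger graph lowers the number of components by at most what it
does in a smaller graph. -/
lemma clusterCount_sup_edge_add_le {G H : SimpleGraph V} (hGH : G ≤ H) {S : Finset V} {a b : V}
    (ha : a ∈ S) (hb : b ∈ S) :
    clusterCount (G ⊔ SimpleGraph.edge a b) S + clusterCount H S ≤
      clusterCount G S + clusterCount (H ⊔ SimpleGraph.edge a b) S := by
  -- If `H` already joins `a` and `b`, the edge changes nothing there. Otherwise they are separated
  -- in `G` too, where the count drops by at least one, while in `H` it drops by at most one.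
  by_cases h : H.Reachable a b
  · rw [← clusterCount_sup_edge_eq h]
    have := clusterCount_mono (G := G) (H := G ⊔ SimpleGraph.edge a b) le_sup_left S
    omega
  · have h1 := clusterCount_sup_edge_add_one_le (G := G) ha hb fun h' => h (h'.mono hGH)
    have h2 := clusterCount_le_sup_edge_add_one H S a b
    omega

end ClusterCount

/-! ### Averages over independent random subsets -/

section RandomSubset

variable {ι : Type*} [DecidableEq ι]

/-- The mean of `F` over a random subset of `E` that contains every element independently with
probability `p`. -/
def subsetMean (p : ℝ) (E : Finset ι) (F : Finset ι → ℝ) : ℝ :=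
  ∑ O ∈ E.powerset, p ^ O.card * (1 - p) ^ (E \ O).card * F O

lemma subsetMean_empty (p : ℝ) (F : Finset ι → ℝ) : subsetMean p ∅ F = F ∅ := by
  simp [subsetMean]

/-- Conditioning on whether `e` is kept; this recursion drives all inductions over the edge set. -/
lemma subsetMean_insert (p : ℝ) {E : Finset ι} {e : ι} (he : e ∉ E) (F : Finset ι → ℝ) :
    subsetMean p (insert e E) F =
      (1 - p) * subsetMean p E F + p * subsetMean p E (fun O => F (insert e O)) := by
  rw [subsetMean, Finset.sum_powerset_insert he, subsetMean, subsetMean, Finset.mul_sum,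
    Finset.mul_sum]
  congr 1 <;> refine Finset.sum_congr rfl fun O hO => ?_
  all_goals
    have hO' := Finset.mem_powerset.1 hO
    have heO : e ∉ O := fun h => he (hO' h)
  · rw [Finset.insert_sdiff_of_notMem _ heO, Finset.card_insert_of_notMem (by simp [he])]
    ring
  · rw [Finset.card_insert_of_notMem heO, Finset.insert_sdiff_insert,
      Finset.sdiff_insert_of_notMem he]
    ring

lemma subsetMean_mono {p : ℝ} (h0 : 0 ≤ p) (h1 : p ≤ 1) {E : Finset ι} {F F' : Finset ι → ℝ}
    (h : ∀ O ⊆ E, F O ≤ F' O) : subsetMean p E F ≤ subsetMean p E F' := by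
  refine Finset.sum_le_sum fun O hO => mul_le_mul_of_nonneg_left (h O (Finset.mem_powerset.1 hO)) ?_
  have : 0 ≤ 1 - p := by linarith
  positivity

lemma subsetMean_const (p : ℝ) (E : Finset ι) (c : ℝ) : subsetMean p E (fun _ => c) = c := by
  induction E using Finset.induction_on with
  | empty => exact subsetMean_empty _ _
  | insert e E he ih => rw [subsetMean_insert p he, ih]; ring

lemma subsetMean_sub (p : ℝ) (E : Finset ι) (F F' : Finset ι → ℝ) :
    subsetMean p E (fun O => F O - F' O) = subsetMean p E F - subsetMean p E F' := by
  simp only [subsetMean, mul_sub, Finset.sum_sub_distrib]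

lemma subsetMean_const_mul (p : ℝ) (E : Finset ι) (c : ℝ) (F : Finset ι → ℝ) :
    subsetMean p E (fun O => c * F O) = c * subsetMean p E F := by
  simp only [subsetMean, Finset.mul_sum]
  exact Finset.sum_congr rfl fun _ _ => by ring

lemma subsetMean_union (p : ℝ) {E E' : Finset ι} (h : Disjoint E E') (F : Finset ι → ℝ) :
    subsetMean p (E ∪ E') F =
      subsetMean p E (fun O => subsetMean p E' (fun O' => F (O ∪ O'))) := by
  induction E using Finset.induction_on generalizing F with
  | empty => simp [subsetMean_empty]
  | insert e E he ih =>
    rw [Finset.disjoint_insert_left] at h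
    rw [Finset.insert_union, subsetMean_insert p (by simp [he, h.1]), subsetMean_insert p he,
      ih h.2, ih h.2]
    simp only [Finset.insert_union]

end RandomSubset

/-! ### Contraction of the mean excess of components over nested shells -/

section Shells

variable {V : Type*} [DecidableEq V]

/-- For a supermodular function, independent choices have a mean no larger than the fully correlated
choice with the same marginals, which keeps all of `E` with probability `p` and nothing otherwise.
-/
lemma subsetMean_clusterCount_le {p : ℝ} (h0 : 0 ≤ p) (h1 : p ≤ 1) (G : SimpleGraph V)
    (S : Finset V) (E : Finset (Sym2 V)) (hE : ∀ e ∈ E, ∀ v ∈ e, v ∈ S) :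
    subsetMean p E (fun O => (clusterCount (G ⊔ .fromEdgeSet (O : Set (Sym2 V))) S : ℝ)) ≤
      p * clusterCount (G ⊔ .fromEdgeSet (E : Set (Sym2 V))) S + (1 - p) * clusterCount G S := by
  induction E using Finset.induction_on generalizing G with
  | empty => simp [subsetMean_empty]; linarith
  | insert e E he ih =>
    have hE' : ∀ e ∈ E, ∀ v ∈ e, v ∈ S := fun e' he' => hE e' (Finset.mem_insert_of_mem he')
    induction e using Sym2.ind with
    | _ a b =>
    have ha : a ∈ S := hE _ (Finset.mem_insert_self _ _) a (by simp)
    have hb : b ∈ S := hE _ (Finset.mem_insert_self _ _) b (by simp)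
    have hins : ∀ O : Finset (Sym2 V), G ⊔ .fromEdgeSet ((insert s(a, b) O : Finset _) : Set _) =
        (G ⊔ SimpleGraph.edge a b) ⊔ .fromEdgeSet (O : Set (Sym2 V)) := by
      intro O
      rw [Finset.coe_insert, Set.insert_eq, SimpleGraph.fromEdgeSet_union, sup_assoc]
      rfl
    have hins' : (G ⊔ SimpleGraph.edge a b) ⊔ .fromEdgeSet (E : Set (Sym2 V)) =
        (G ⊔ .fromEdgeSet (E : Set (Sym2 V))) ⊔ SimpleGraph.edge a b := sup_right_comm _ _ _
    rw [subsetMean_insert p he]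
    simp only [hins]
    have i1 := ih G hE'
    have i2 := ih (G ⊔ SimpleGraph.edge a b) hE'
    rw [hins'] at i2 ⊢
    have key := clusterCount_sup_edge_add_le
      (G := G) (H := G ⊔ .fromEdgeSet (E : Set (Sym2 V))) le_sup_left ha hb
    have key' : (clusterCount (G ⊔ SimpleGraph.edge a b) S : ℝ) +
        clusterCount (G ⊔ .fromEdgeSet (E : Set (Sym2 V))) S ≤ clusterCount G S +
        clusterCount (G ⊔ .fromEdgeSet (E : Set (Sym2 V)) ⊔ SimpleGraph.edge a b) S := by
      exact_mod_cast key
    have hq : 0 ≤ 1 - p := by linarith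
    have j1 := mul_le_mul_of_nonneg_left i1 hq
    have j2 := mul_le_mul_of_nonneg_left i2 h0
    -- After conditioning on the new edge, the two induction hypotheses miss the claim by exactly `p
    -- * (1 - p)` times the supermodularity inequality.
    have j3 := mul_le_mul_of_nonneg_left key' (mul_nonneg h0 hq)
    nlinarith

/-- With all of `E` present only one component is left, so the excess survives only in the other
term of the convex combination. -/
lemma subsetMean_clusterCount_sub_one_le {p : ℝ} (h0 : 0 ≤ p) (h1 : p ≤ 1) {S : Finset V}
    {E : Finset (Sym2 V)} (hE : ∀ e ∈ E, ∀ v ∈ e, v ∈ S)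
    (hconn : ∀ a ∈ S, ∀ b ∈ S, (SimpleGraph.fromEdgeSet (E : Set (Sym2 V))).Reachable a b)
    (G : SimpleGraph V) :
    subsetMean p E
      (fun O => (clusterCount (G ⊔ .fromEdgeSet (O : Set (Sym2 V))) S : ℝ) - 1) ≤
        (1 - p) * (clusterCount G S - 1) := by
  rw [subsetMean_sub, subsetMean_const]
  have h2 := subsetMean_clusterCount_le h0 h1 G S E hE
  have h3 : clusterCount (G ⊔ .fromEdgeSet (E : Set (Sym2 V))) S ≤ 1 :=
    clusterCount_le_one_iff.2 fun a ha b hb => (hconn a ha b hb).mono le_sup_right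
  have h3' : (clusterCount (G ⊔ .fromEdgeSet (E : Set (Sym2 V))) S : ℝ) ≤ 1 := by
    exact_mod_cast h3
  have h4 := mul_le_mul_of_nonneg_left h3' h0
  linarith

/-- Nested shells `S (m - 1), …, S 0`: every point of a shell is joined to the next outer shell by
`G₀`, and the edges `E i` connect the shell `S i`. If the edges are kept independently with
probability `p`, then the mean number of excess components decreases geometrically. -/
lemma subsetMean_clusterCount_shells_le {p : ℝ} (h0 : 0 ≤ p) (h1 : p ≤ 1) (G₀ : SimpleGraph V)
    (S : ℕ → Finset V) (E : ℕ → Finset (Sym2 V)) (m : ℕ)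
    (hE : ∀ i ≤ m, ∀ e ∈ E i, ∀ v ∈ e, v ∈ S i)
    (hconn : ∀ i ≤ m, ∀ a ∈ S i, ∀ b ∈ S i,
      (SimpleGraph.fromEdgeSet (E i : Set (Sym2 V))).Reachable a b)
    (hdisj : ∀ i ≤ m, ∀ j < i, Disjoint (E i) (E j))
    (hnest : ∀ i < m, ∀ a ∈ S i, ∃ b ∈ S (i + 1), G₀.Reachable a b)
    (G : SimpleGraph V) (hG : G₀ ≤ G) :
    subsetMean p ((Finset.range (m + 1)).biUnion E)
      (fun O => (clusterCount (G ⊔ .fromEdgeSet (O : Set (Sym2 V))) (S 0) : ℝ) - 1) ≤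
      (1 - p) ^ (m + 1) * (clusterCount G (S m) - 1) := by
  have hq : 0 ≤ 1 - p := by linarith
  induction m generalizing G with
  | zero => 
    simpa using subsetMean_clusterCount_sub_one_le h0 h1 (hE 0 le_rfl) (hconn 0 le_rfl) G
  | succ m ih =>
    -- The outermost shell is revealed first. Given its kept edges `O`, the induction hypothesis
    -- handles the inner shells over the base graph enlarged by `O`, which is why `G` is general.
    rw [Finset.range_add_one, Finset.biUnion_insert, subsetMean_union]
    · have step : ∀ O ⊆ E (m + 1), subsetMean p ((Finset.range (m + 1)).biUnion E) (fun O' =>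
          (clusterCount (G ⊔ .fromEdgeSet ((O ∪ O' : Finset _) : Set (Sym2 V))) (S 0) : ℝ) - 1) ≤
          (1 - p) ^ (m + 1) *
            (clusterCount (G ⊔ .fromEdgeSet (O : Set (Sym2 V))) (S (m + 1)) - 1) := by
        intro O _
        have hsup : ∀ O' : Finset (Sym2 V),
            G ⊔ .fromEdgeSet ((O ∪ O' : Finset _) : Set (Sym2 V)) =
              (G ⊔ .fromEdgeSet (O : Set (Sym2 V))) ⊔ .fromEdgeSet (O' : Set (Sym2 V)) := by
          intro O'
          rw [Finset.coe_union, SimpleGraph.fromEdgeSet_union, sup_assoc]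
        simp only [hsup]
        refine (ih (fun i hi => hE i (by omega)) (fun i hi => hconn i (by omega))
          (fun i hi => hdisj i (by omega)) (fun i hi => hnest i (by omega)) _
          (hG.trans le_sup_left)).trans ?_
        refine mul_le_mul_of_nonneg_left ?_ (pow_nonneg hq _)
        have : clusterCount (G ⊔ .fromEdgeSet (O : Set (Sym2 V))) (S m) ≤
            clusterCount (G ⊔ .fromEdgeSet (O : Set (Sym2 V))) (S (m + 1)) := by
          refine clusterCount_le_of_reachable fun z hz => ?_
          obtain ⟨w, hw, hzw⟩ := hnest m (by omega) z hz
          exact ⟨w, hw, hzw.mono (hG.trans le_sup_left)⟩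
        have : (clusterCount (G ⊔ .fromEdgeSet (O : Set (Sym2 V))) (S m) : ℝ) ≤
            clusterCount (G ⊔ .fromEdgeSet (O : Set (Sym2 V))) (S (m + 1)) := by
          exact_mod_cast this
        linarith
      refine (subsetMean_mono h0 h1 step).trans ?_
      rw [subsetMean_const_mul]
      calc _ ≤ (1 - p) ^ (m + 1) * ((1 - p) * (clusterCount G (S (m + 1)) - 1)) :=
            mul_le_mul_of_nonneg_left (subsetMean_clusterCount_sub_one_le h0 h1
              (hE _ le_rfl) (hconn _ le_rfl) G) (pow_nonneg hq _)
        _ = _ := by ring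
    · rw [Finset.disjoint_biUnion_right]
      intro j hj
      exact hdisj _ le_rfl _ (Finset.mem_range.1 hj)

end Shells

/-! ### Lattice geometry: distances, unit steps and connected shells -/

section Lattice

variable {d : ℕ}

/-- The supremum distance of two lattice points. -/
def supDist (x y : Fin d → ℤ) : ℕ := Finset.univ.sup fun k => (x k - y k).natAbs

/-- The `1`-distance of two lattice points. -/
def sumDist (x y : Fin d → ℤ) : ℕ := ∑ k, (x k - y k).natAbs

lemma supDist_le_iff {x y : Fin d → ℤ} {m : ℕ} :
    supDist x y ≤ m ↔ ∀ k, (x k - y k).natAbs ≤ m := by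
  simp [supDist]

lemma natAbs_sub_le_supDist (x y : Fin d → ℤ) (k : Fin d) : (x k - y k).natAbs ≤ supDist x y :=
  supDist_le_iff.1 le_rfl k

lemma supDist_comm (x y : Fin d → ℤ) : supDist x y = supDist y x := by
  simp only [supDist]
  congr 1
  ext k
  omega

lemma supDist_triangle (x y z : Fin d → ℤ) : supDist x z ≤ supDist x y + supDist y z := by
  refine supDist_le_iff.2 fun k => ?_
  have := natAbs_sub_le_supDist x y k
  have := natAbs_sub_le_supDist y z k
  omega

lemma supDist_self (x : Fin d → ℤ) : supDist x x = 0 :=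
  Nat.le_zero.1 (supDist_le_iff.2 fun k => by simp)

lemma exists_natAbs_eq_supDist {x y : Fin d → ℤ} (h : 0 < supDist x y) :
    ∃ k, (x k - y k).natAbs = supDist x y := by
  by_contra! hne
  have : supDist x y ≤ supDist x y - 1 := supDist_le_iff.2 fun k => by
    have := natAbs_sub_le_supDist x y k
    have := hne k
    omega
  omega

lemma supDist_le_sumDist (x y : Fin d → ℤ) : supDist x y ≤ sumDist x y :=
  supDist_le_iff.2 fun k =>
    Finset.single_le_sum (f := fun k => (x k - y k).natAbs) (fun _ _ => Nat.zero_le _)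
      (Finset.mem_univ k)

lemma sumDist_le_mul_supDist (x y : Fin d → ℤ) : sumDist x y ≤ d * supDist x y := by
  calc sumDist x y ≤ ∑ _k : Fin d, supDist x y :=
        Finset.sum_le_sum fun k _ => natAbs_sub_le_supDist x y k
    _ = _ := by simp

lemma sumDist_comm (x y : Fin d → ℤ) : sumDist x y = sumDist y x := by
  refine Finset.sum_congr rfl fun k _ => ?_
  omega

lemma coe_sumDist (x y : Fin d → ℤ) : (sumDist x y : ℤ) = ∑ k, |x k - y k| := by
  simp [sumDist]

lemma ne_of_sumDist_eq_one {x y : Fin d → ℤ} (h : sumDist x y = 1) : x ≠ y := by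
  rintro rfl
  simp [sumDist] at h

lemma sumDist_update_self (x : Fin d → ℤ) (k : Fin d) (c : ℤ) :
    sumDist x (Function.update x k c) = (x k - c).natAbs := by
  rw [sumDist, Finset.sum_eq_single k]
  · simp
  · intro j _ hj
    simp [Function.update_of_ne hj]
  · simp

/-- The additive form avoids truncated subtraction. -/
lemma sumDist_update_add {x y : Fin d → ℤ} (k : Fin d) (c : ℤ) :
    sumDist (Function.update x k c) y + (x k - y k).natAbs =
      sumDist x y + (c - y k).natAbs := by
  have h := Finset.add_sum_erase Finset.univ (fun j => (x j - y j).natAbs) (Finset.mem_univ k)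
  have h' := Finset.add_sum_erase Finset.univ
    (fun j => (Function.update x k c j - y j).natAbs) (Finset.mem_univ k)
  have e : ∑ j ∈ Finset.univ.erase k, (Function.update x k c j - y j).natAbs =
      ∑ j ∈ Finset.univ.erase k, (x j - y j).natAbs :=
    Finset.sum_congr rfl fun j hj => by rw [Function.update_of_ne (Finset.ne_of_mem_erase hj)]
  rw [e] at h'
  simp only [Function.update_self] at h'
  unfold sumDist
  omega

/-- From a lattice point in a box one can move to another one by a unit step towards it that does
not leave the box. -/
lemma exists_step {a b x y : Fin d → ℤ} (hx : x ∈ Set.Icc a b) (hy : y ∈ Set.Icc a b)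
    (hne : x ≠ y) : ∃ z ∈ Set.Icc a b, sumDist x z = 1 ∧ sumDist z y + 1 = sumDist x y := by
  obtain ⟨k, hk⟩ := Function.ne_iff.1 hne
  have hxk : a k ≤ x k := hx.1 k
  have hxk' : x k ≤ b k := hx.2 k
  have hyk : a k ≤ y k := hy.1 k
  have hyk' : y k ≤ b k := hy.2 k
  obtain ⟨c, hc1, hc2, hc3, hc4⟩ : ∃ c : ℤ, a k ≤ c ∧ c ≤ b k ∧ (x k - c).natAbs = 1 ∧
      (c - y k).natAbs + 1 = (x k - y k).natAbs := by
    rcases lt_or_gt_of_ne hk with h | h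
    · exact ⟨x k + 1, by omega, by omega, by omega, by omega⟩
    · exact ⟨x k - 1, by omega, by omega, by omega, by omega⟩
  refine ⟨Function.update x k c, ⟨?_, ?_⟩, ?_, ?_⟩
  · intro j
    by_cases hj : j = k
    · subst hj; simpa using hc1
    · rw [Function.update_of_ne hj]; exact hx.1 j
  · intro j
    by_cases hj : j = k
    · subst hj; simpa using hc2
    · rw [Function.update_of_ne hj]; exact hx.2 j
  · rw [sumDist_update_self, hc3]
  · have := sumDist_update_add (x := x) (y := y) k c
    omega

/-- The nearest neighbour graph of the lattice, restricted to `A`. -/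
def latticeOn (A : Set (Fin d → ℤ)) : SimpleGraph (Fin d → ℤ) where
  Adj x y := sumDist x y = 1 ∧ x ∈ A ∧ y ∈ A
  symm := ⟨fun x y h => ⟨by rw [sumDist_comm]; exact h.1, h.2.2, h.2.1⟩⟩
  loopless := ⟨fun x h => ne_of_sumDist_eq_one h.1 rfl⟩

lemma latticeOn_mono {A B : Set (Fin d → ℤ)} (h : A ⊆ B) : latticeOn A ≤ latticeOn B :=
  fun _ _ hxy => ⟨hxy.1, h hxy.2.1, h hxy.2.2⟩

lemma latticeOn_Icc_reachable {a b x y : Fin d → ℤ} (hx : x ∈ Set.Icc a b)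
    (hy : y ∈ Set.Icc a b) : (latticeOn (Set.Icc a b)).Reachable x y := by
  induction h : sumDist x y using Nat.strong_induction_on generalizing x with
  | _ n ih =>
    by_cases hne : x = y
    · subst hne; exact .rfl
    obtain ⟨z, hz, hxz, hzy⟩ := exists_step hx hy hne
    have h1 : (latticeOn (Set.Icc a b)).Adj x z := ⟨hxz, hx, hz⟩
    exact h1.reachable.trans (ih _ (by omega) hz rfl)

/-- The points of the lattice cube at supremum distance `m` from `x`. -/
def latticeShell (N : ℕ) (x : Fin d → ℤ) (m : ℕ) : Set (Fin d → ℤ) :=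
  {z | z ∈ latticeCube d N ∧ supDist x z = m}

lemma mem_latticeCube {N : ℕ} {x : Fin d → ℤ} :
    x ∈ latticeCube d N ↔ ∀ k, 0 ≤ x k ∧ x k ≤ N := by
  simp only [latticeCube, Set.mem_Icc, Pi.le_def, ← forall_and]
  rfl

/-- The shell is a union of faces, each a box cut off by the cube and hence connected. Faces in
different coordinate directions intersect. Since `2 * m ≤ N`, every direction has a face inside the
cube. -/
lemma latticeShell_reachable (hd : 2 ≤ d) {N : ℕ} {x : Fin d → ℤ} (hx : x ∈ latticeCube d N)
    {m : ℕ} (hm : 0 < m) (hmN : 2 * m ≤ N) {y z : Fin d → ℤ} (hy : y ∈ latticeShell N x m)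
    (hz : z ∈ latticeShell N x m) : (latticeOn (latticeShell N x m)).Reachable y z := by
  rw [mem_latticeCube] at hx
  let a : Fin d → ℤ := fun k => max 0 (x k - m)
  let b : Fin d → ℤ := fun k => min N (x k + m)
  let face : Fin d → ℤ → Set (Fin d → ℤ) := fun k c =>
    Set.Icc (Function.update a k c) (Function.update b k c)
  let valid : Fin d → ℤ → Prop := fun k c => 0 ≤ c ∧ c ≤ N ∧ (x k - c).natAbs = m
  have mem_face : ∀ k c w, w ∈ face k c ↔
      w k = c ∧ ∀ j, j ≠ k → 0 ≤ w j ∧ w j ≤ N ∧ (x j - w j).natAbs ≤ m := by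
    intro k c w
    constructor
    · rintro ⟨h1, h2⟩
      refine ⟨le_antisymm (by simpa using h2 k) (by simpa using h1 k), fun j hj => ?_⟩
      have h1j := h1 j
      have h2j := h2 j
      rw [Function.update_of_ne hj] at h1j h2j
      simp only [a, b] at h1j h2j
      omega
    · rintro ⟨h1, h2⟩
      constructor
      · intro j
        by_cases hj : j = k
        · subst hj; simp [h1]
        · rw [Function.update_of_ne hj]
          have := h2 j hj
          simp only [a]
          omega
      · intro j
        by_cases hj : j = k
        · subst hj; simp [h1]
        · rw [Function.update_of_ne hj]
          have := h2 j hj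
          simp only [b]
          omega
  have face_sub : ∀ k c, valid k c → face k c ⊆ latticeShell N x m := by
    intro k c hc w hw
    rw [mem_face] at hw
    obtain ⟨h1, h2⟩ := hw
    obtain ⟨c0, c1, c2⟩ := hc
    refine ⟨mem_latticeCube.2 fun j => ?_, le_antisymm (supDist_le_iff.2 fun j => ?_) ?_⟩
    · by_cases hj : j = k
      · subst hj; omega
      · have := h2 j hj; omega
    · by_cases hj : j = k
      · subst hj; omega
      · have := h2 j hj; omega
    · have := natAbs_sub_le_supDist x w k
      rw [h1] at this
      omega
  have in_face : ∀ w ∈ latticeShell N x m, ∃ k c, valid k c ∧ w ∈ face k c := by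
    rintro w ⟨hw, hwm⟩
    rw [mem_latticeCube] at hw
    obtain ⟨k, hk⟩ := exists_natAbs_eq_supDist (x := x) (y := w) (by omega)
    refine ⟨k, w k, ⟨(hw k).1, (hw k).2, by omega⟩, (mem_face _ _ _).2 ⟨rfl, fun j _ => ?_⟩⟩
    have := natAbs_sub_le_supDist x w j
    exact ⟨(hw j).1, (hw j).2, by omega⟩
  have conn_face : ∀ k c, valid k c → ∀ u ∈ face k c, ∀ v ∈ face k c,
      (latticeOn (latticeShell N x m)).Reachable u v := fun k c hc u hu v hv =>
    (latticeOn_Icc_reachable hu hv).mono (latticeOn_mono (face_sub k c hc))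
  have valid_ex : ∀ k, ∃ c, valid k c := by
    intro k
    have := hx k
    by_cases h : (m : ℤ) ≤ x k
    · exact ⟨x k - m, by omega, by omega, by omega⟩
    · exact ⟨x k + m, by omega, by omega, by omega⟩
  have meet : ∀ k l c e, k ≠ l → valid k c → valid l e → ∃ w, w ∈ face k c ∧ w ∈ face l e := by
    intro k l c e hkl hc he
    obtain ⟨c0, c1, c2⟩ := hc
    obtain ⟨e0, e1, e2⟩ := he
    refine ⟨Function.update (Function.update x k c) l e, ?_, ?_⟩
    · refine (mem_face _ _ _).2 ⟨by simp [hkl], fun j hj => ?_⟩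
      by_cases hjl : j = l
      · subst hjl; simp only [Function.update_self]; omega
      · rw [Function.update_of_ne hjl, Function.update_of_ne hj]
        have := hx j
        omega
    · refine (mem_face _ _ _).2 ⟨by simp, fun j hj => ?_⟩
      rw [Function.update_of_ne hj]
      by_cases hjk : j = k
      · subst hjk; simp only [Function.update_self]; omega
      · rw [Function.update_of_ne hjk]
        have := hx j
        omega
  have conn_ne : ∀ k l c e, k ≠ l → valid k c → valid l e → ∀ u ∈ face k c, ∀ v ∈ face l e,
      (latticeOn (latticeShell N x m)).Reachable u v := by
    intro k l c e hkl hc he u hu v hv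
    obtain ⟨w, hw, hw'⟩ := meet k l c e hkl hc he
    exact (conn_face k c hc u hu w hw).trans (conn_face l e he w hw' v hv)
  obtain ⟨k, c, hc, hyk⟩ := in_face y hy
  obtain ⟨l, e, he, hzl⟩ := in_face z hz
  by_cases hkl : k = l
  · subst hkl
    have : Nontrivial (Fin d) := Fin.nontrivial_iff_two_le.2 hd
    obtain ⟨j, hj⟩ := exists_ne k
    obtain ⟨f, hf⟩ := valid_ex j
    obtain ⟨w, hw, -⟩ := meet j k f e hj hf he
    exact (conn_ne k j c f hj.symm hc hf y hyk w hw).trans (conn_ne j k f e hj hf he w hw z hzl)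
  · exact conn_ne k l c e hkl hc he y hyk z hzl

/-- Some point of the lattice cube is far away from a given one. -/
lemma exists_supDist_ge (hd : 0 < d) {N : ℕ} {x : Fin d → ℤ} (hx : x ∈ latticeCube d N) {m : ℕ}
    (hmN : 2 * m ≤ N) : ∃ z ∈ latticeCube d N, m ≤ supDist x z := by
  have hx' := mem_latticeCube.1 hx ⟨0, hd⟩
  by_cases h : (m : ℤ) ≤ x ⟨0, hd⟩
  · refine ⟨0, mem_latticeCube.2 fun k => by simp, ?_⟩
    refine le_trans ?_ (natAbs_sub_le_supDist _ _ ⟨0, hd⟩)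
    simp only [Pi.zero_apply]
    omega
  · refine ⟨fun _ => N, mem_latticeCube.2 fun k => by simp, ?_⟩
    refine le_trans ?_ (natAbs_sub_le_supDist _ _ ⟨0, hd⟩)
    omega

lemma card_Icc_supDist (x : Fin d → ℤ) (r : ℕ) :
    (Finset.Icc (fun k => x k - r) (fun k => x k + r)).card = (2 * r + 1) ^ d := by
  rw [Pi.card_Icc]
  simp only [Int.card_Icc]
  rw [Finset.prod_congr rfl (g := fun _ => 2 * r + 1) (fun k _ => by omega)]
  simp

end Lattice

/-! ### The backbone within balls and across shells -/

section Backbone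

variable {d N : ℕ} {X : ℕ → Fin d → ℤ}

lemma IsBackbone.mem_cube (hX : IsBackbone d N X) {i : ℕ} (hi : i < latticeCard d N) :
    X i ∈ latticeCube d N := hX.bijOn.mapsTo hi

lemma IsBackbone.injOn (hX : IsBackbone d N X) {i j : ℕ} (hi : i < latticeCard d N)
    (hj : j < latticeCard d N) (h : X i = X j) : i = j := hX.bijOn.injOn hi hj h

lemma IsBackbone.exists_label (hX : IsBackbone d N X) {z : Fin d → ℤ} (hz : z ∈ latticeCube d N) :
    ∃ i < latticeCard d N, X i = z := hX.bijOn.surjOn hz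

lemma IsBackbone.sumDist_succ (hX : IsBackbone d N X) {i : ℕ} (hi : i + 1 < latticeCard d N) :
    sumDist (X i) (X (i + 1)) = 1 := by
  rw [sumDist_comm]
  have := hX.step i hi
  rw [← coe_sumDist] at this
  exact_mod_cast this

/-- The labels of the lattice points at supremum distance at most `r` from `x`. -/
def ballLabels (N : ℕ) (X : ℕ → Fin d → ℤ) (x : Fin d → ℤ) (r : ℕ) : Finset ℕ :=
  (Finset.range (latticeCard d N)).filter fun i => supDist x (X i) ≤ r

/-- The labels of the lattice points at supremum distance `r` from `x`. -/
def shellLabels (N : ℕ) (X : ℕ → Fin d → ℤ) (x : Fin d → ℤ) (r : ℕ) : Finset ℕ :=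
  (Finset.range (latticeCard d N)).filter fun i => supDist x (X i) = r

lemma mem_ballLabels {x : Fin d → ℤ} {r i : ℕ} :
    i ∈ ballLabels N X x r ↔ i < latticeCard d N ∧ supDist x (X i) ≤ r := by
  simp [ballLabels]

lemma mem_shellLabels {x : Fin d → ℤ} {r i : ℕ} :
    i ∈ shellLabels N X x r ↔ i < latticeCard d N ∧ supDist x (X i) = r := by
  simp [shellLabels]

lemma shellLabels_subset_ballLabels (x : Fin d → ℤ) (r : ℕ) :
    shellLabels N X x r ⊆ ballLabels N X x r := fun i hi => by
  rw [mem_shellLabels] at hi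
  exact mem_ballLabels.2 ⟨hi.1, hi.2.le⟩

lemma IsBackbone.card_ballLabels_le (hX : IsBackbone d N X) (x : Fin d → ℤ) (r : ℕ) :
    (ballLabels N X x r).card ≤ (2 * r + 1) ^ d := by
  rw [← card_Icc_supDist x r]
  refine Finset.card_le_card_of_injOn X ?_ ?_
  · intro i hi
    have h := supDist_le_iff.1 (mem_ballLabels.1 hi).2
    rw [Finset.mem_coe, Finset.mem_Icc]
    constructor <;> intro k <;> have := h k <;> simp only <;> omega
  · intro i hi j hj hij
    exact hX.injOn (mem_ballLabels.1 hi).1 (mem_ballLabels.1 hj).1 hij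

/-- The part of the backbone whose steps stay within distance `r` of `x`. -/
def backboneOn (N : ℕ) (X : ℕ → Fin d → ℤ) (x : Fin d → ℤ) (r : ℕ) : SimpleGraph ℕ where
  Adj i j := (i + 1 = j ∨ j + 1 = i) ∧ i ∈ ballLabels N X x r ∧ j ∈ ballLabels N X x r
  symm := ⟨fun _ _ h => ⟨h.1.symm, h.2.2, h.2.1⟩⟩
  loopless := ⟨fun i h => by rcases h.1 with h | h <;> omega⟩

lemma IsBackbone.supDist_succ_le (hX : IsBackbone d N X) (x : Fin d → ℤ) {i : ℕ}
    (hi : i + 1 < latticeCard d N) :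
    supDist x (X (i + 1)) ≤ supDist x (X i) + 1 ∧ supDist x (X i) ≤ supDist x (X (i + 1)) + 1 := by
  have h := supDist_le_sumDist (X i) (X (i + 1))
  rw [hX.sumDist_succ hi] at h
  have h1 := supDist_triangle x (X i) (X (i + 1))
  have h2 := supDist_triangle x (X (i + 1)) (X i)
  rw [supDist_comm (X (i + 1))] at h2
  omega

/-- A backbone point that is closer than `m` to `x` is joined, within the ball of radius `m`, to a
backbone point at distance `m`, if there is a backbone point at distance at least `m`. -/
lemma IsBackbone.exists_reachable_shell (hX : IsBackbone d N X) (x : Fin d → ℤ) {m : ℕ} {i j : ℕ}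
    (hi : i < latticeCard d N) (hj : j < latticeCard d N) (hi' : supDist x (X i) ≤ m)
    (hj' : m ≤ supDist x (X j)) :
    ∃ l ∈ shellLabels N X x m, (backboneOn N X x m).Reachable i l := by
  -- The truncated differences add up to |i - j|. The backbone is followed from `i` towards `j`; the
  -- sup distance to `x` changes by at most one per step, so it takes the value `m` before exceeding
  -- it.
  induction h : (j - i) + (i - j) generalizing i with
  | zero =>
    obtain rfl : i = j := by omega
    exact ⟨i, mem_shellLabels.2 ⟨hi, le_antisymm hi' hj'⟩, .rfl⟩
  | succ n ih =>
    by_cases him : supDist x (X i) = m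
    · exact ⟨i, mem_shellLabels.2 ⟨hi, him⟩, .rfl⟩
    rcases lt_or_gt_of_ne (show i ≠ j by omega) with hij | hij
    · have hs := hX.supDist_succ_le x (i := i) (by omega)
      obtain ⟨l, hl, hil⟩ := ih (i := i + 1) (by omega) (by omega) (by omega)
      have hadj : (backboneOn N X x m).Adj i (i + 1) :=
        ⟨Or.inl rfl, mem_ballLabels.2 ⟨hi, hi'⟩, mem_ballLabels.2 ⟨by omega, by omega⟩⟩
      exact ⟨l, hl, hadj.reachable.trans hil⟩
    · obtain ⟨i, rfl⟩ : ∃ i', i = i' + 1 := ⟨i - 1, by omega⟩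
      have hs := hX.supDist_succ_le x (i := i) (by omega)
      obtain ⟨l, hl, hil⟩ := ih (i := i) (by omega) (by omega) (by omega)
      have hadj : (backboneOn N X x m).Adj (i + 1) i :=
        ⟨Or.inr rfl, mem_ballLabels.2 ⟨hi, hi'⟩, mem_ballLabels.2 ⟨by omega, by omega⟩⟩
      exact ⟨l, hl, hadj.reachable.trans hil⟩

lemma backboneOn_mono (x : Fin d → ℤ) {m r : ℕ} (h : m ≤ r) :
    backboneOn N X x m ≤ backboneOn N X x r := by
  have hsub : ballLabels N X x m ⊆ ballLabels N X x r := fun i hi =>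
    mem_ballLabels.2 ⟨(mem_ballLabels.1 hi).1, (mem_ballLabels.1 hi).2.trans h⟩
  exact fun i j hij => ⟨hij.1, hsub hij.2.1, hsub hij.2.2⟩

/-- The pairs of labels of neighbouring lattice points that both lie at distance `m` from `x`. -/
def shellEdges (N : ℕ) (X : ℕ → Fin d → ℤ) (x : Fin d → ℤ) (m : ℕ) : Finset (Sym2 ℕ) :=
  ((shellLabels N X x m ×ˢ shellLabels N X x m).filter
    fun q => sumDist (X q.1) (X q.2) = 1).image fun q => s(q.1, q.2)

lemma mem_shellEdges {x : Fin d → ℤ} {m i j : ℕ} : s(i, j) ∈ shellEdges N X x m ↔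
    i ∈ shellLabels N X x m ∧ j ∈ shellLabels N X x m ∧ sumDist (X i) (X j) = 1 := by
  simp only [shellEdges, Finset.mem_image, Finset.mem_filter, Finset.mem_product, Prod.exists,
    Sym2.eq_iff]
  constructor
  · rintro ⟨a, b, ⟨⟨ha, hb⟩, hab⟩, ⟨rfl, rfl⟩ | ⟨rfl, rfl⟩⟩
    · exact ⟨ha, hb, hab⟩
    · exact ⟨hb, ha, by rw [sumDist_comm]; exact hab⟩
  · rintro ⟨hi, hj, hij⟩
    exact ⟨i, j, ⟨⟨hi, hj⟩, hij⟩, Or.inl ⟨rfl, rfl⟩⟩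

/-- The labelling carries `latticeShell_reachable` over as a graph homomorphism. Off the cube the
label function takes a junk value. -/
lemma IsBackbone.shellEdges_reachable (hX : IsBackbone d N X) (hd : 2 ≤ d) {x : Fin d → ℤ}
    (hx : x ∈ latticeCube d N) {m : ℕ} (hm : 0 < m) (hmN : 2 * m ≤ N) {i j : ℕ}
    (hi : i ∈ shellLabels N X x m) (hj : j ∈ shellLabels N X x m) :
    (SimpleGraph.fromEdgeSet (shellEdges N X x m : Set (Sym2 ℕ))).Reachable i j := by
  have hlab : ∀ z : Fin d → ℤ, ∃ i, z ∈ latticeCube d N → i < latticeCard d N ∧ X i = z := by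
    intro z
    by_cases hz : z ∈ latticeCube d N
    · obtain ⟨i, hi⟩ := hX.exists_label hz
      exact ⟨i, fun _ => hi⟩
    · exact ⟨0, fun h => absurd h hz⟩
  choose lab hlab using hlab
  have hmem : ∀ z ∈ latticeShell N x m, lab z ∈ shellLabels N X x m := by
    rintro z ⟨hz, hzm⟩
    refine mem_shellLabels.2 ⟨(hlab z hz).1, ?_⟩
    rw [(hlab z hz).2, hzm]
  let φ : latticeOn (latticeShell N x m) →g
      SimpleGraph.fromEdgeSet (shellEdges N X x m : Set (Sym2 ℕ)) :=
    { toFun := lab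
      map_rel' := by
        intro y z hyz
        have h1 := hlab y hyz.2.1.1
        have h2 := hlab z hyz.2.2.1
        rw [SimpleGraph.fromEdgeSet_adj]
        refine ⟨?_, fun h => ne_of_sumDist_eq_one hyz.1 (by rw [← h1.2, ← h2.2, h])⟩
        rw [Finset.mem_coe, mem_shellEdges]
        exact ⟨hmem y hyz.2.1, hmem z hyz.2.2, by rw [h1.2, h2.2]; exact hyz.1⟩ }
  have hX' : ∀ i ∈ shellLabels N X x m, X i ∈ latticeShell N x m ∧ lab (X i) = i := by
    intro i hi
    rw [mem_shellLabels] at hi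
    have hc := hX.mem_cube hi.1
    exact ⟨⟨hc, hi.2⟩, hX.injOn (hlab _ hc).1 hi.1 (hlab _ hc).2⟩
  have := (latticeShell_reachable hd hx hm hmN (hX' i hi).1 (hX' j hj).1).map φ
  rw [show φ (X i) = i from (hX' i hi).2, show φ (X j) = j from (hX' j hj).2] at this
  exact this

end Backbone

/-! ### Probabilities of open and closed pairs -/

section Marks

/-- The elements of `E` whose mark is at most the threshold. -/
noncomputable def openSet (g : Sym2 ℕ → ℝ) (E : Finset (Sym2 ℕ)) (u : Sym2 ℕ → ℝ) : Finset (Sym2 ℕ) :=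
  open Classical in E.filter fun e => u e ≤ g e

lemma mem_openSet {g : Sym2 ℕ → ℝ} {E : Finset (Sym2 ℕ)} {u : Sym2 ℕ → ℝ} {e : Sym2 ℕ} :
    e ∈ openSet g E u ↔ e ∈ E ∧ u e ≤ g e := by
  simp [openSet]

lemma openSet_subset (g : Sym2 ℕ → ℝ) (E : Finset (Sym2 ℕ)) (u : Sym2 ℕ → ℝ) :
    openSet g E u ⊆ E := fun _ he => (mem_openSet.1 he).1

variable {Ω : Type*} [MeasurableSpace Ω] {P : Measure Ω} {U : Sym2 ℕ → Ω → ℝ}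

lemma IsUniformMarks.measure_le (hU : IsUniformMarks P U) (e : Sym2 ℕ) {g : ℝ} (h1 : g ≤ 1) :
    P (U e ⁻¹' Set.Iic g) = ENNReal.ofReal g := by
  rw [← Measure.map_apply (hU.measurable_mark e) measurableSet_Iic, hU.uniform,
    Measure.restrict_apply measurableSet_Iic]
  have : Set.Iic g ∩ Set.Icc (0 : ℝ) 1 = Set.Icc 0 g := by
    ext x
    simp only [Set.mem_inter_iff, Set.mem_Iic, Set.mem_Icc]
    exact ⟨fun h => ⟨h.2.1, h.1⟩, fun h => ⟨h.2, h.1, h.2.trans h1⟩⟩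
  rw [this, Real.volume_Icc, sub_zero]

lemma IsUniformMarks.measure_gt (hU : IsUniformMarks P U) (e : Sym2 ℕ) {g : ℝ} (h0 : 0 ≤ g) :
    P (U e ⁻¹' Set.Ioi g) = ENNReal.ofReal (1 - g) := by
  rw [← Measure.map_apply (hU.measurable_mark e) measurableSet_Ioi, hU.uniform,
    Measure.restrict_apply measurableSet_Ioi]
  have : Set.Ioi g ∩ Set.Icc (0 : ℝ) 1 = Set.Ioc g 1 := by
    ext x
    simp only [Set.mem_inter_iff, Set.mem_Ioi, Set.mem_Icc, Set.mem_Ioc]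
    exact ⟨fun h => ⟨h.1, h.2.2⟩, fun h => ⟨h.1, h0.trans h.1.le, h.2⟩⟩
  rw [this, Real.volume_Ioc]

lemma IsUniformMarks.measure_biInter (hU : IsUniformMarks P U) (E : Finset (Sym2 ℕ))
    {A : Sym2 ℕ → Set ℝ} (hA : ∀ e, MeasurableSet (A e)) :
    P (⋂ e ∈ E, U e ⁻¹' A e) = ∏ e ∈ E, P (U e ⁻¹' A e) :=
  (iIndepFun_iff_measure_inter_preimage_eq_mul.1 hU.indep) E fun e _ => hA e

lemma IsUniformMarks.measure_forall_gt (hU : IsUniformMarks P U) (E : Finset (Sym2 ℕ))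
    {g : Sym2 ℕ → ℝ} (h0 : ∀ e, 0 ≤ g e) :
    P {ω | ∀ e ∈ E, g e < U e ω} = ∏ e ∈ E, ENNReal.ofReal (1 - g e) := by
  rw [show {ω | ∀ e ∈ E, g e < U e ω} = ⋂ e ∈ E, U e ⁻¹' Set.Ioi (g e) by ext; simp,
    hU.measure_biInter E fun e => measurableSet_Ioi]
  exact Finset.prod_congr rfl fun e _ => hU.measure_gt e (h0 e)

lemma openSet_eq_iff {g : Sym2 ℕ → ℝ} {E O : Finset (Sym2 ℕ)} (hO : O ⊆ E) {u : Sym2 ℕ → ℝ} :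
    openSet g E u = O ↔ (∀ e ∈ O, u e ≤ g e) ∧ ∀ e ∈ E \ O, g e < u e := by
  constructor
  · rintro rfl
    refine ⟨fun e he => (mem_openSet.1 he).2, fun e he => ?_⟩
    rw [Finset.mem_sdiff, mem_openSet] at he
    by_contra h
    exact he.2 ⟨he.1, not_lt.1 h⟩
  · rintro ⟨h1, h2⟩
    ext e
    rw [mem_openSet]
    refine ⟨fun he => ?_, fun he => ⟨hO he, h1 e he⟩⟩
    by_contra h
    exact (h2 e (Finset.mem_sdiff.2 ⟨he.1, h⟩)).not_ge he.2

/-- The event prescribes the marks on the disjoint sets `O`, `E \ O` and `T` separately, so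
independence factorizes it. -/
lemma IsUniformMarks.measure_openSet_eq_and (hU : IsUniformMarks P U) {g : Sym2 ℕ → ℝ}
    (h0 : ∀ e, 0 ≤ g e) (h1 : ∀ e, g e ≤ 1) {E O T : Finset (Sym2 ℕ)} (hO : O ⊆ E)
    (hT : Disjoint E T) :
    P {ω | openSet g E (fun e => U e ω) = O ∧ ∀ e ∈ T, g e < U e ω} =
      (∏ e ∈ O, ENNReal.ofReal (g e)) * (∏ e ∈ E \ O, ENNReal.ofReal (1 - g e)) *
        ∏ e ∈ T, ENNReal.ofReal (1 - g e) := by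
  classical
  let A : Sym2 ℕ → Set ℝ := fun e => if e ∈ O then Set.Iic (g e) else Set.Ioi (g e)
  have hA : ∀ e, MeasurableSet (A e) := by
    intro e
    simp only [A]
    split_ifs
    exacts [measurableSet_Iic, measurableSet_Ioi]
  have hTO : ∀ e ∈ T, e ∉ O := fun e he heO => Finset.disjoint_left.1 hT (hO heO) he
  have hset : {ω | openSet g E (fun e => U e ω) = O ∧ ∀ e ∈ T, g e < U e ω} =
      ⋂ e ∈ (O ∪ (E \ O)) ∪ T, U e ⁻¹' A e := by
    ext ω
    simp only [Set.mem_ofPred_eq, openSet_eq_iff hO, Finset.mem_union, Set.mem_iInter,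
      Set.mem_preimage, or_imp, forall_and]
    refine and_congr (and_congr ?_ ?_) ?_ <;> refine forall₂_congr fun e he => ?_
    · simp [A, he]
    · simp [A, (Finset.mem_sdiff.1 he).2]
    · simp [A, hTO e he]
  rw [hset, hU.measure_biInter _ hA, Finset.prod_union, Finset.prod_union Finset.disjoint_sdiff]
  · congr 1
    · congr 1 <;> refine Finset.prod_congr rfl fun e he => ?_
      · simp only [A, if_pos he]; exact hU.measure_le e (h1 e)
      · simp only [A, if_neg (Finset.mem_sdiff.1 he).2]; exact hU.measure_gt e (h0 e)
    · refine Finset.prod_congr rfl fun e he => ?_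
      simp only [A, if_neg (hTO e he)]; exact hU.measure_gt e (h0 e)
  · rw [Finset.union_sdiff_of_subset hO]; exact hT

/-- If a property of the set of open pairs forces `F ≥ 1`, then its probability is at most the mean
of `F`. -/
lemma IsUniformMarks.measure_openSet_le_subsetMean (hU : IsUniformMarks P U) {g : Sym2 ℕ → ℝ}
    {p : ℝ} (h0 : 0 ≤ p) (h1 : p ≤ 1) {E : Finset (Sym2 ℕ)} (hg : ∀ e ∈ E, g e = p)
    {F : Finset (Sym2 ℕ) → ℝ} (hF : ∀ O, 0 ≤ F O) {bad : Finset (Sym2 ℕ) → Prop}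
    (hbad : ∀ O ⊆ E, bad O → 1 ≤ F O) :
    P {ω | bad (openSet g E fun e => U e ω)} ≤ ENNReal.ofReal (subsetMean p E F) := by
  classical
  have hq : 0 ≤ 1 - p := by linarith
  have hopen : ∀ u, openSet g E u = openSet (fun _ => p) E u := by
    intro u
    ext e
    simp only [mem_openSet]
    exact and_congr_right fun he => by rw [hg e he]
  -- Markov's inequality, by summing over the finitely many values of the open set.
  have hsub : {ω | bad (openSet g E fun e => U e ω)} ⊆
      ⋃ O ∈ E.powerset.filter bad, {ω | openSet g E (fun e => U e ω) = O} := by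
    intro ω hω
    simp only [Set.mem_iUnion, Finset.mem_filter, Finset.mem_powerset, exists_prop]
    exact ⟨_, ⟨openSet_subset g E _, hω⟩, rfl⟩
  refine (measure_mono hsub).trans ((measure_biUnion_finset_le _ _).trans ?_)
  rw [subsetMean, ENNReal.ofReal_sum_of_nonneg fun O _ =>
    mul_nonneg (mul_nonneg (pow_nonneg h0 _) (pow_nonneg hq _)) (hF O)]
  refine (Finset.sum_le_sum fun O hO => ?_).trans
    (Finset.sum_le_sum_of_subset (Finset.filter_subset bad _))
  rw [Finset.mem_filter, Finset.mem_powerset] at hO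
  have h := hU.measure_openSet_eq_and (g := fun _ => p) (fun _ => h0) (fun _ => h1) hO.1
    (Finset.disjoint_empty_right E)
  simp only [Finset.notMem_empty, IsEmpty.forall_iff, implies_true, and_true, Finset.prod_const,
    Finset.card_empty, pow_zero, mul_one] at h
  simp only [hopen]
  rw [h, ← ENNReal.ofReal_pow h0, ← ENNReal.ofReal_pow hq,
    ← ENNReal.ofReal_mul (pow_nonneg h0 _)]
  exact ENNReal.ofReal_le_ofReal (le_mul_of_one_le_right
    (mul_nonneg (pow_nonneg h0 _) (pow_nonneg hq _)) (hbad O hO.1 hO.2))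

/-- Marks outside `E` are independent of a choice that depends on the open pairs of `E`. -/
lemma IsUniformMarks.measure_forall_mem_choice_le (hU : IsUniformMarks P U) {g : Sym2 ℕ → ℝ}
    (h0 : ∀ e, 0 ≤ g e) (h1 : ∀ e, g e ≤ 1) {E : Finset (Sym2 ℕ)}
    (T : Finset (Sym2 ℕ) → Finset (Sym2 ℕ)) {good : Finset (Sym2 ℕ) → Prop} {θ : ℝ} {L : ℕ}
    (hT : ∀ O, good O → Disjoint E (T O)) (hcard : ∀ O, good O → (T O).card = L)
    (hθ : ∀ O, good O → ∀ e ∈ T O, 1 - g e ≤ θ) :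
    P {ω | good (openSet g E fun e => U e ω) ∧
      ∀ e ∈ T (openSet g E fun e => U e ω), g e < U e ω} ≤ ENNReal.ofReal θ ^ L := by
  classical
  -- Total mass one is the case of the empty product in the independence formula.
  have hprob : P Set.univ = 1 := by
    have := hU.measure_forall_gt ∅ h0
    simpa using this
  have hsub : {ω | good (openSet g E fun e => U e ω) ∧
      ∀ e ∈ T (openSet g E fun e => U e ω), g e < U e ω} ⊆
      ⋃ O ∈ E.powerset.filter good,
        {ω | openSet g E (fun e => U e ω) = O ∧ ∀ e ∈ T O, g e < U e ω} := by
    intro ω hω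
    simp only [Set.mem_iUnion, Finset.mem_filter, Finset.mem_powerset, exists_prop]
    exact ⟨_, ⟨openSet_subset g E _, hω.1⟩, rfl, hω.2⟩
  refine (measure_mono hsub).trans ((measure_biUnion_finset_le _ _).trans ?_)
  have hsum : ∑ O ∈ E.powerset, P {ω | openSet g E (fun e => U e ω) = O} ≤ 1 := by
    rw [← hprob, ← measure_biUnion_finset]
    · exact measure_mono (Set.subset_univ _)
    · intro O _ O' _ hne
      exact Set.disjoint_left.2 fun ω h h' => hne (h.symm.trans h')
    · intro O hO
      have : {ω | openSet g E (fun e => U e ω) = O} =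
          (⋂ e ∈ O, U e ⁻¹' Set.Iic (g e)) ∩ ⋂ e ∈ E \ O, U e ⁻¹' Set.Ioi (g e) := by
        ext ω
        simp only [Set.mem_ofPred_eq, openSet_eq_iff (Finset.mem_powerset.1 hO)]
        simp
      rw [this]
      exact (Finset.measurableSet_biInter _ fun e _ =>
        hU.measurable_mark e measurableSet_Iic).inter (Finset.measurableSet_biInter _ fun e _ =>
        hU.measurable_mark e measurableSet_Ioi)
  -- For each fixed value `O` of the open set, `T O` is a deterministic set of `L` pairs outside
  -- `E`, which contributes the factor θ^L.
  calc _ ≤ ∑ O ∈ E.powerset.filter good,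
        P {ω | openSet g E (fun e => U e ω) = O} * ENNReal.ofReal θ ^ L := by
        refine Finset.sum_le_sum fun O hO => ?_
        rw [Finset.mem_filter, Finset.mem_powerset] at hO
        have h := hU.measure_openSet_eq_and h0 h1 hO.1 (Finset.disjoint_empty_right E)
        simp only [Finset.notMem_empty, IsEmpty.forall_iff, implies_true, and_true,
          Finset.prod_empty, mul_one] at h
        rw [h, hU.measure_openSet_eq_and h0 h1 hO.1 (hT O hO.2)]
        gcongr
        rw [← hcard O hO.2, ← Finset.prod_const]
        exact Finset.prod_le_prod' fun e he => ENNReal.ofReal_le_ofReal (hθ O hO.2 e he)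
    _ = (∑ O ∈ E.powerset.filter good, P {ω | openSet g E (fun e => U e ω) = O}) *
        ENNReal.ofReal θ ^ L := (Finset.sum_mul _ _ _).symm
    _ ≤ 1 * ENNReal.ofReal θ ^ L := by
        gcongr
        exact (Finset.sum_le_sum_of_subset (Finset.filter_subset good _)).trans hsum
    _ = _ := one_mul _

end Marks

/-! ### The connection function -/

section ConnProb

variable {d : ℕ}

lemma connProb_nonneg {β : ℝ} (hβ : 0 < β) (s : ℝ) (x : Fin d → ℝ) : 0 ≤ connProb β s x := by
  have h : 0 ≤ oneNorm x := Finset.sum_nonneg fun _ _ => abs_nonneg _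
  have : -β * oneNorm x ^ (-s) ≤ 0 := by
    have := Real.rpow_nonneg h (-s)
    nlinarith
  have := Real.exp_le_one_iff.2 this
  unfold connProb
  linarith

lemma connProb_le_one (β s : ℝ) (x : Fin d → ℝ) : connProb β s x ≤ 1 := by
  unfold connProb
  linarith [Real.exp_pos (-β * oneNorm x ^ (-s))]

lemma oneNorm_sub_comm (x y : Fin d → ℝ) : oneNorm (x - y) = oneNorm (y - x) :=
  Finset.sum_congr rfl fun k _ => by simp [abs_sub_comm]

lemma connProb_sub_comm (β s : ℝ) (x y : Fin d → ℝ) :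
    connProb β s (x - y) = connProb β s (y - x) := by
  simp only [connProb, oneNorm_sub_comm]

lemma oneNorm_lattice_sub (x y : Fin d → ℤ) :
    oneNorm ((fun k => (x k : ℝ)) - fun k => (y k : ℝ)) = sumDist x y := by
  simp only [oneNorm, sumDist, Pi.sub_apply, Nat.cast_sum]
  refine Finset.sum_congr rfl fun k _ => ?_
  rw [Nat.cast_natAbs]
  push_cast
  rfl

/-- Points at distance at most `t` are not joined with probability at most `exp (-β t ^ (-s))`. -/
lemma one_sub_connProb_le {β s : ℝ} (hβ : 0 < β) (hs : 0 < s) {x : Fin d → ℝ} {t : ℝ}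
    (h0 : 0 < oneNorm x) (ht : oneNorm x ≤ t) :
    1 - connProb β s x ≤ Real.exp (-β * t ^ (-s)) := by
  have h := Real.rpow_le_rpow_of_nonpos h0 ht (show -s ≤ 0 by linarith)
  simp only [connProb, sub_sub_cancel, Real.exp_le_exp]
  nlinarith

end ConnProb

/-! ### Adjacency in the random graph -/

section Graph

variable {d N : ℕ} {β s : ℝ} {X : ℕ → Fin d → ℤ} {K : ℕ} {Y : ℕ → Fin d → ℝ} {U : Sym2 ℕ → ℝ}

/-- The threshold below which the mark of a pair of labels makes the pair an edge. -/
noncomputable def threshold (d N : ℕ) (β s : ℝ) (X : ℕ → Fin d → ℤ) (Y : ℕ → Fin d → ℝ) : Sym2 ℕ → ℝ :=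
  Sym2.lift ⟨fun i j => connProb β s (position d N X Y i - position d N X Y j),
    fun _ _ => connProb_sub_comm _ _ _ _⟩

lemma threshold_mk (i j : ℕ) : threshold d N β s X Y s(i, j) =
    connProb β s (position d N X Y i - position d N X Y j) := rfl

lemma threshold_nonneg (hβ : 0 < β) (e : Sym2 ℕ) : 0 ≤ threshold d N β s X Y e := by
  induction e using Sym2.ind with
  | _ i j => exact connProb_nonneg hβ s _

lemma threshold_le_one (e : Sym2 ℕ) : threshold d N β s X Y e ≤ 1 := by
  induction e using Sym2.ind with
  | _ i j => exact connProb_le_one β s _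

/-- The form used throughout: it is symmetric in `i` and `j` and expressed through a threshold on
unordered pairs. -/
lemma graph_adj_iff {i j : ℕ} : (graph d N β s X K Y U).Adj i j ↔
    i ≠ j ∧ i < latticeCard d N + K ∧ j < latticeCard d N + K ∧
      (((i + 1 = j ∨ j + 1 = i) ∧ i < latticeCard d N ∧ j < latticeCard d N) ∨
        U s(i, j) ≤ threshold d N β s X Y s(i, j)) := by
  rw [graph, SimpleGraph.fromRel_adj, threshold_mk, Sym2.eq_swap (a := j) (b := i),
    connProb_sub_comm β s (position d N X Y j)]
  constructor
  · rintro ⟨hne, ⟨h1, h2, h3⟩ | ⟨h1, h2, h3⟩⟩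
    · exact ⟨hne, by omega, h2, h3.imp (fun h => by omega) id⟩
    · exact ⟨hne, h2, by omega, h3.imp (fun h => by omega) id⟩
  · rintro ⟨hne, h1, h2, h3⟩
    refine ⟨hne, ?_⟩
    rcases lt_or_gt_of_ne hne with h | h
    · exact Or.inl ⟨h, h2, h3.imp (fun h => by omega) id⟩
    · exact Or.inr ⟨h, h1, h3.imp (fun h => by omega) id⟩

lemma position_of_lt {i : ℕ} (hi : i < latticeCard d N) :
    position d N X Y i = fun k => (X i k : ℝ) := if_pos hi

lemma threshold_lattice {i j : ℕ} (hi : i < latticeCard d N) (hj : j < latticeCard d N) :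
    threshold d N β s X Y s(i, j) = 1 - Real.exp (-β * (sumDist (X i) (X j) : ℝ) ^ (-s)) := by
  rw [threshold_mk, position_of_lt hi, position_of_lt hj, connProb, oneNorm_lattice_sub]

/-- Vertices that are joined inside a finite set of vertices have a graph distance of at most its
number of elements. -/
lemma edist_le_card_of_reachable {V : Type*} {G H : SimpleGraph V} (hHG : H ≤ G) {B : Finset V}
    (hB : ∀ u v, H.Adj u v → u ∈ B) {u v : V} (huv : H.Reachable u v) :
    G.edist u v ≤ B.card := by
  classical
  obtain ⟨w⟩ := huv
  obtain ⟨p, hp⟩ := w.toPath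
  -- A nontrivial path visits only vertices carrying an edge of `H`, each of them once. The trivial
  -- path is separate, since its vertex need not lie in `B`.
  by_cases hnil : p.Nil
  · rw [hnil.eq]; simp
  have hsub : p.support.toFinset ⊆ B := by
    intro z hz
    rw [List.mem_toFinset] at hz
    by_cases hzv : z = u
    · subst hzv
      exact hB _ _ (p.adj_snd hnil)
    · obtain ⟨q, hq⟩ : ∃ q, H.Adj z q := by
        obtain ⟨i, hi, hil⟩ := SimpleGraph.Walk.mem_support_iff_exists_getVert.1 hz
        have hi0 : i ≠ 0 := by rintro rfl; exact hzv (by simpa using hi.symm)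
        have := p.adj_getVert_succ (i := i - 1) (by omega)
        rw [show i - 1 + 1 = i by omega, hi] at this
        exact ⟨_, this.symm⟩
      exact hB _ _ hq
  have hlen : p.length + 1 ≤ B.card := by
    rw [← SimpleGraph.Walk.length_support, ← List.toFinset_card_of_nodup hp.support_nodup]
    exact Finset.card_le_card hsub
  refine (SimpleGraph.edist_anti hHG).trans ((SimpleGraph.edist_le p).trans ?_)
  exact_mod_cast (by omega : p.length ≤ B.card)

end Graph

/-! ### Lattice neighbours are close in the graph -/

section Neighbours

variable {d N : ℕ} {β s : ℝ} {X : ℕ → Fin d → ℤ}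
  {Ω : Type*} [MeasurableSpace Ω] {P : Measure Ω} {U : Sym2 ℕ → Ω → ℝ}

/-- At unit distance the power law equals one, so all shell pairs share one probability, whatever
`s` and the Poisson points are. -/
lemma threshold_shellEdges (Y : ℕ → Fin d → ℝ) {x : Fin d → ℤ} {m : ℕ} {e : Sym2 ℕ}
    (he : e ∈ shellEdges N X x m) : threshold d N β s X Y e = 1 - Real.exp (-β) := by
  induction e using Sym2.ind with
  | _ i j =>
    obtain ⟨hi, hj, hij⟩ := mem_shellEdges.1 he
    rw [threshold_lattice (mem_shellLabels.1 hi).1 (mem_shellLabels.1 hj).1, hij]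
    simp

/-- The shells of radius 1, …, `r` around `X i₀` start with at most `(2 * r + 1) ^ d` components,
and each contributes a factor `Real.exp (-β)`. If the unit shell ends up in one component, `i₀`,
which the backbone joins to that shell, is connected to each lattice neighbour inside the ball, and
a path there is no longer than the number of its sites. -/
lemma IsBackbone.measure_far_neighbour_le (hX : IsBackbone d N X) (hd : 2 ≤ d) (hβ : 0 < β)
    (hU : IsUniformMarks P U) {r : ℕ} (hr : 0 < r) (hrN : 2 * r ≤ N) (K : Ω → ℕ)
    (Y : ℕ → Ω → Fin d → ℝ) {i₀ : ℕ} (hi₀ : i₀ < latticeCard d N) :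
    P {ω | ∃ j < latticeCard d N, sumDist (X i₀) (X j) = 1 ∧
      (((2 * r + 1) ^ d : ℕ) : ℕ∞) <
        (graph d N β s X (K ω) (fun i => Y i ω) (fun e => U e ω)).edist i₀ j} ≤
      ENNReal.ofReal ((2 * r + 1) ^ d * Real.exp (-β) ^ r) := by
  obtain ⟨m, rfl⟩ : ∃ m, r = m + 1 := ⟨r - 1, by omega⟩
  set x := X i₀ with hx
  have hxc : x ∈ latticeCube d N := hX.mem_cube hi₀
  set p : ℝ := 1 - Real.exp (-β) with hp
  have hp0 : 0 ≤ p := by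
    have := Real.exp_le_one_iff.2 (show -β ≤ 0 by linarith)
    linarith
  have hp1 : p ≤ 1 := by linarith [Real.exp_pos (-β)]
  set S : ℕ → Finset ℕ := fun i => shellLabels N X x (i + 1) with hS
  set E : ℕ → Finset (Sym2 ℕ) := fun i => shellEdges N X x (i + 1) with hE
  set EE : Finset (Sym2 ℕ) := (Finset.range (m + 1)).biUnion E with hEE
  set G₀ := backboneOn N X x (m + 1) with hG₀
  obtain ⟨f, hf, hxf⟩ : ∃ f < latticeCard d N, m + 1 ≤ supDist x (X f) := by
    obtain ⟨z, hz, hxz⟩ := exists_supDist_ge (by omega) hxc hrN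
    obtain ⟨f, hf, rfl⟩ := hX.exists_label hz
    exact ⟨f, hf, hxz⟩
  have hshell : ∀ k, k ≤ m + 1 → ∀ i < latticeCard d N, supDist x (X i) ≤ k →
      ∃ l ∈ shellLabels N X x k, G₀.Reachable i l := by
    intro k hk i hi hik
    obtain ⟨l, hl, hil⟩ := hX.exists_reachable_shell x hi hf hik (by omega)
    exact ⟨l, hl, hil.mono (backboneOn_mono x hk)⟩
  have hmain := subsetMean_clusterCount_shells_le hp0 hp1 G₀ S E m
    (by
      intro i _ e he v hv
      induction e using Sym2.ind with
      | _ a b =>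
        obtain ⟨ha, hb, -⟩ := mem_shellEdges.1 he
        rcases Sym2.mem_iff.1 hv with rfl | rfl
        exacts [ha, hb])
    (fun i hi a ha b hb => hX.shellEdges_reachable hd hxc (by omega) (by omega) ha hb)
    (by
      intro i _ j hj
      refine Finset.disjoint_left.2 fun e he he' => ?_
      induction e using Sym2.ind with
      | _ a b =>
        have h1 := (mem_shellLabels.1 (mem_shellEdges.1 he).1).2
        have h2 := (mem_shellLabels.1 (mem_shellEdges.1 he').1).2
        omega)
    (by
      intro i hi a ha
      have ha' := mem_shellLabels.1 ha
      exact hshell (i + 1 + 1) (by omega) a ha'.1 (by omega))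
    G₀ le_rfl
  have hEEball : ∀ a b, s(a, b) ∈ EE → a ∈ ballLabels N X x (m + 1) ∧ b < latticeCard d N ∧
      a < latticeCard d N := by
    intro a b hab
    obtain ⟨k, hk, hab⟩ := Finset.mem_biUnion.1 hab
    obtain ⟨ha, hb, -⟩ := mem_shellEdges.1 hab
    have hk' := Finset.mem_range.1 hk
    rw [mem_shellLabels] at ha hb
    exact ⟨mem_ballLabels.2 ⟨ha.1, by omega⟩, hb.1, ha.1⟩
  -- Zero is a dummy Poisson configuration, which makes the threshold deterministic; thresholds of
  -- shell pairs do not depend on it.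
  set g := threshold d N β s X (fun _ => 0) with hg
  have hgE : ∀ e ∈ EE, ∀ Y : ℕ → Fin d → ℝ, threshold d N β s X Y e = p := by
    intro e he Y
    obtain ⟨k, _, he⟩ := Finset.mem_biUnion.1 he
    exact threshold_shellEdges Y he
  let count : Finset (Sym2 ℕ) → ℕ := fun O =>
    clusterCount (G₀ ⊔ .fromEdgeSet (O : Set (Sym2 ℕ))) (S 0)
  have hcount : ∀ O, 1 ≤ count O := by
    intro O
    obtain ⟨l, hl, -⟩ := hshell 1 (by omega) i₀ hi₀ (by rw [← hx, supDist_self]; omega)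
    exact clusterCount_pos _ hl
  have hprob := hU.measure_openSet_le_subsetMean hp0 hp1 (g := g) (E := EE)
    (fun e he => hgE e he _) (F := fun O => (count O : ℝ) - 1)
    (fun O => by have := hcount O; simpa using this) (bad := fun O => ¬ count O ≤ 1)
    (fun O _ h => by
      have : (2 : ℝ) ≤ count O := by exact_mod_cast (by omega : 2 ≤ count O)
      linarith)
  refine (measure_mono ?_).trans (hprob.trans (ENNReal.ofReal_le_ofReal (hmain.trans ?_)))
  · rintro ω ⟨j, hj, hij, hlt⟩ hle
    refine hlt.not_ge ?_
    have hall := clusterCount_le_one_iff.1 hle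
    obtain ⟨l, hl, hil⟩ := hshell 1 (by omega) i₀ hi₀ (by rw [← hx, supDist_self]; omega)
    have hjs : j ∈ S 0 := by
      refine mem_shellLabels.2 ⟨hj, le_antisymm ((supDist_le_sumDist _ _).trans hij.le) ?_⟩
      by_contra h0
      refine ne_of_sumDist_eq_one hij (funext fun k => ?_)
      have := natAbs_sub_le_supDist x (X j) k
      omega
    have hreach := (hil.mono (le_sup_left : G₀ ≤ G₀ ⊔ .fromEdgeSet
      ((openSet g EE fun e => U e ω : Finset _) : Set (Sym2 ℕ)))).trans (hall l hl j hjs)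
    refine (edist_le_card_of_reachable (G := graph d N β s X (K ω) (fun i => Y i ω)
      (fun e => U e ω)) (B := ballLabels N X x (m + 1)) ?_ ?_ hreach).trans ?_
    · refine sup_le ?_ ?_
      · intro a b hab
        obtain ⟨h1, h2, h3⟩ := hab
        rw [mem_ballLabels] at h2 h3
        exact graph_adj_iff.2 ⟨by omega, by omega, by omega, Or.inl ⟨h1, h2.1, h3.1⟩⟩
      · intro a b hab
        rw [SimpleGraph.fromEdgeSet_adj, Finset.mem_coe, mem_openSet] at hab
        obtain ⟨⟨h1, h2⟩, hne⟩ := hab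
        obtain ⟨-, h4, h5⟩ := hEEball a b h1
        refine graph_adj_iff.2 ⟨hne, by omega, by omega, Or.inr ?_⟩
        rw [hgE _ h1]
        rwa [hg, hgE _ h1] at h2
    · intro a b hab
      rcases (SimpleGraph.sup_adj _ _ _ _).1 hab with hab | hab
      · exact hab.2.1
      · rw [SimpleGraph.fromEdgeSet_adj, Finset.mem_coe, mem_openSet] at hab
        exact (hEEball a b hab.1.1).1
    · exact_mod_cast hX.card_ballLabels_le x (m + 1)
  · have h1 : clusterCount G₀ (S m) ≤ (2 * (m + 1) + 1) ^ d :=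
      (clusterCount_le_card _ _).trans
        ((Finset.card_le_card (shellLabels_subset_ballLabels x (m + 1))).trans
          (hX.card_ballLabels_le x (m + 1)))
    have h2 : (clusterCount G₀ (S m) : ℝ) ≤ (2 * ((m + 1 : ℕ) : ℝ) + 1) ^ d := by
      exact_mod_cast h1
    rw [hp, sub_sub_cancel, mul_comm]
    exact mul_le_mul_of_nonneg_right (by linarith) (pow_nonneg (Real.exp_pos _).le _)

/-- A step of size one that cannot return to the previous point continues in the same direction.
Lattice neighbours are then consecutive on the backbone, which replaces the shell argument: in
dimension one a shell may consist of two separate points. -/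
lemma IsBackbone.eq_of_dim_one {X : ℕ → Fin 1 → ℤ} (hX : IsBackbone 1 N X) {i : ℕ}
    (hi : i < latticeCard 1 N) : X i 0 = i := by
  induction i using Nat.strong_induction_on with
  | _ i ih =>
    rcases i with _ | i
    · rw [hX.start]; simp
    · have h1 := hX.sumDist_succ hi
      have h2 := ih i (by omega) (by omega)
      simp only [sumDist, Finset.univ_unique, Fin.default_eq_zero, Fin.isValue,
        Finset.sum_singleton] at h1
      have h3 := mem_latticeCube.1 (hX.mem_cube hi) 0
      rcases i with _ | i
      · push_cast at *
        omega
      · have h4 := ih i (by omega) (by omega)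
        have h5 : X (i + 1 + 1) 0 ≠ X i 0 := by
          intro h
          have := hX.injOn hi (show i < latticeCard 1 N by omega)
            (funext fun k => by rw [Subsingleton.elim k 0]; exact h)
          omega
        push_cast at *
        omega

/-- With high probability, neighbouring lattice points have a small graph distance. -/
lemma IsBackbone.measure_exists_far_neighbours_le (hX : IsBackbone d N X) (hd : 0 < d)
    (hβ : 0 < β) (hU : IsUniformMarks P U) {r : ℕ} (hr : 0 < r) (hrN : 2 * r ≤ N) (K : Ω → ℕ)
    (Y : ℕ → Ω → Fin d → ℝ) :
    P {ω | ∃ i < latticeCard d N, ∃ j < latticeCard d N, sumDist (X i) (X j) = 1 ∧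
      (((2 * r + 1) ^ d : ℕ) : ℕ∞) <
        (graph d N β s X (K ω) (fun i => Y i ω) (fun e => U e ω)).edist i j} ≤
      ENNReal.ofReal ((N + 1) ^ d * ((2 * r + 1) ^ d * Real.exp (-β) ^ r)) := by
  rcases (show d = 1 ∨ 2 ≤ d by omega) with rfl | hd2
  · refine le_trans (le_of_eq ?_) zero_le
    rw [show {ω | ∃ i < latticeCard 1 N, ∃ j < latticeCard 1 N, sumDist (X i) (X j) = 1 ∧
      (((2 * r + 1) ^ 1 : ℕ) : ℕ∞) <
        (graph 1 N β s X (K ω) (fun i => Y i ω) (fun e => U e ω)).edist i j} = ∅ from ?_,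
      measure_empty]
    refine Set.eq_empty_of_forall_notMem fun ω => ?_
    rintro ⟨i, hi, j, hj, hij, hlt⟩
    refine hlt.not_ge (le_trans (b := 1) ?_ ?_)
    · refine SimpleGraph.edist_le_one_iff_adj_or_eq.2 (Or.inl (graph_adj_iff.2
        ⟨?_, by omega, by omega, Or.inl ⟨?_, hi, hj⟩⟩))
      · rintro rfl; exact ne_of_sumDist_eq_one hij rfl
      · have h1 := hX.eq_of_dim_one hi
        have h2 := hX.eq_of_dim_one hj
        have h3 : sumDist (X i) (X j) = (X i 0 - X j 0).natAbs := by simp [sumDist]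
        rw [hij, h1, h2] at h3
        omega
    · exact_mod_cast Nat.one_le_pow 1 (2 * r + 1) (by omega)
  · have hsub : {ω | ∃ i < latticeCard d N, ∃ j < latticeCard d N, sumDist (X i) (X j) = 1 ∧
        (((2 * r + 1) ^ d : ℕ) : ℕ∞) <
          (graph d N β s X (K ω) (fun i => Y i ω) (fun e => U e ω)).edist i j} ⊆
        ⋃ i ∈ Finset.range (latticeCard d N), {ω | ∃ j < latticeCard d N,
          sumDist (X i) (X j) = 1 ∧ (((2 * r + 1) ^ d : ℕ) : ℕ∞) <
          (graph d N β s X (K ω) (fun i => Y i ω) (fun e => U e ω)).edist i j} := by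
      rintro ω ⟨i, hi, h⟩
      simp only [Set.mem_iUnion, Finset.mem_range, exists_prop]
      exact ⟨i, hi, h⟩
    refine (measure_mono hsub).trans ((measure_biUnion_finset_le _ _).trans ?_)
    refine (Finset.sum_le_sum fun i hi => hX.measure_far_neighbour_le hd2 hβ hU hr hrN K Y
      (Finset.mem_range.1 hi)).trans ?_
    rw [Finset.sum_const, Finset.card_range, nsmul_eq_mul, ← ENNReal.ofReal_natCast,
      ← ENNReal.ofReal_mul (by positivity)]
    simp [latticeCard]

end Neighbours

/-! ### Long edges between boxes around distant sites -/

section LongEdges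

variable {d N : ℕ} {β s : ℝ} {X : ℕ → Fin d → ℤ}
  {Ω : Type*} [MeasurableSpace Ω] {P : Measure Ω} {U : Sym2 ℕ → Ω → ℝ}

/-- Around every lattice point there is a full box of side `r` inside the lattice cube. -/
lemma IsBackbone.exists_box_labels (hX : IsBackbone d N X) {i r : ℕ} (hi : i < latticeCard d N)
    (hrN : 2 * r ≤ N) : ∃ Q : Finset ℕ,
      (∀ j ∈ Q, j < latticeCard d N ∧ supDist (X i) (X j) ≤ r) ∧ (r + 1) ^ d ≤ Q.card := by
  classical
  -- In each coordinate the box extends towards the farther side of the cube, where there is room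
  -- for `r ≤ N / 2`.
  let lo : Fin d → ℤ := fun k => if 2 * X i k ≤ N then X i k else X i k - r
  have hlo : ∀ k, 0 ≤ lo k ∧ lo k + r ≤ N ∧ lo k ≤ X i k ∧ X i k ≤ lo k + r := by
    intro k
    have := mem_latticeCube.1 (hX.mem_cube hi) k
    simp only [lo]
    split_ifs <;> omega
  refine ⟨(Finset.range (latticeCard d N)).filter fun j => ∀ k, lo k ≤ X j k ∧ X j k ≤ lo k + r,
    ?_, ?_⟩
  · intro j hj
    rw [Finset.mem_filter, Finset.mem_range] at hj
    refine ⟨hj.1, supDist_le_iff.2 fun k => ?_⟩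
    have := hlo k
    have := hj.2 k
    omega
  · have hcard : (Finset.Icc lo (fun k => lo k + r)).card = (r + 1) ^ d := by
      rw [Pi.card_Icc]
      simp only [Int.card_Icc]
      rw [Finset.prod_congr rfl (g := fun _ => r + 1) (fun k _ => by omega)]
      simp
    rw [← hcard]
    refine Finset.card_le_card_of_surjOn X ?_
    intro z hz
    rw [Finset.mem_coe, Finset.mem_Icc] at hz
    have hz' : ∀ k, lo k ≤ z k ∧ z k ≤ lo k + r := fun k => ⟨hz.1 k, hz.2 k⟩
    obtain ⟨j, hj, rfl⟩ := hX.exists_label (z := z) (mem_latticeCube.2 fun k => by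
      have := hlo k
      have := hz' k
      omega)
    exact ⟨j, by simpa using ⟨hj, hz'⟩, rfl⟩

/-- Disjointness of `Q` and `Q'` makes the unordered pairs distinct, so their marks are `Q.card *
Q'.card` independent trials. -/
lemma IsBackbone.measure_no_edge_le (hX : IsBackbone d N X) (hβ : 0 < β) (hs : 0 < s)
    (hU : IsUniformMarks P U) (K : Ω → ℕ) (Y : ℕ → Ω → Fin d → ℝ) {Q Q' : Finset ℕ}
    (hQ : ∀ a ∈ Q, a < latticeCard d N) (hQ' : ∀ b ∈ Q', b < latticeCard d N)
    (hdisj : Disjoint Q Q') {t : ℕ} (ht : ∀ a ∈ Q, ∀ b ∈ Q', sumDist (X a) (X b) ≤ t) :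
    P {ω | ∀ a ∈ Q, ∀ b ∈ Q',
      ¬ (graph d N β s X (K ω) (fun i => Y i ω) (fun e => U e ω)).Adj a b} ≤
      ENNReal.ofReal (Real.exp (-β * (t : ℝ) ^ (-s))) ^ (Q.card * Q'.card) := by
  classical
  let E : Finset (Sym2 ℕ) := (Q ×ˢ Q').image fun q => s(q.1, q.2)
  have hne : ∀ a ∈ Q, ∀ b ∈ Q', a ≠ b := fun a ha b hb h =>
    Finset.disjoint_left.1 hdisj ha (h ▸ hb)
  have hE : E.card = Q.card * Q'.card := by
    rw [← Finset.card_product]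
    refine Finset.card_image_of_injOn ?_
    rintro ⟨a, b⟩ hab ⟨a', b'⟩ hab' h
    simp only [Finset.coe_product, Set.mem_prod, Finset.mem_coe] at hab hab'
    rcases Sym2.eq_iff.1 h with ⟨h1, h2⟩ | ⟨h1, h2⟩
    · exact Prod.ext h1 h2
    · exact absurd h1 (hne a hab.1 b' hab'.2)
  let g := threshold d N β s X (fun _ => 0)
  have hprob := hU.measure_forall_gt E (g := g) fun e => threshold_nonneg hβ e
  refine (measure_mono ?_).trans (hprob.le.trans ?_)
  · intro ω hω e he
    obtain ⟨⟨a, b⟩, hab, rfl⟩ := Finset.mem_image.1 he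
    obtain ⟨ha, hb⟩ := Finset.mem_product.1 hab
    by_contra h
    have ha' := hQ a ha
    have hb' := hQ' b hb
    refine hω a ha b hb (graph_adj_iff.2 ⟨hne a ha b hb, by omega, by omega, Or.inr ?_⟩)
    have := not_lt.1 h
    simp only [g] at this
    rwa [threshold_lattice ha' hb'] at this ⊢
  · rw [← hE, ← Finset.prod_const]
    refine Finset.prod_le_prod' fun e he => ENNReal.ofReal_le_ofReal ?_
    obtain ⟨⟨a, b⟩, hab, rfl⟩ := Finset.mem_image.1 he
    obtain ⟨ha, hb⟩ := Finset.mem_product.1 hab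
    simp only [g, threshold_mk]
    have hn : oneNorm (position d N X (fun _ => 0) a - position d N X (fun _ => 0) b) =
        sumDist (X a) (X b) := by
      rw [position_of_lt (hQ a ha), position_of_lt (hQ' b hb), oneNorm_lattice_sub]
    refine one_sub_connProb_le hβ hs ?_ ?_
    · rw [hn]
      have : 0 < sumDist (X a) (X b) := by
        by_contra h0
        refine hne a ha b hb (hX.injOn (hQ a ha) (hQ' b hb) (funext fun k => ?_))
        have h1 := natAbs_sub_le_supDist (X a) (X b) k
        have h2 := supDist_le_sumDist (X a) (X b)
        omega
      exact_mod_cast this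
    · rw [hn]
      exact_mod_cast ht a ha b hb

/-- With R the distance of the sites and r = ⌊R^γ⌋, a box of (r + 1)^d ≥ R^{γd} sites lies near each
of them. Since 2r < R the boxes are disjoint, and cross distances are at most d(R + 2r) ≤ 2dR. The
exponent is thus at least β(2dR)^{-s} R^{2dγ}. -/
lemma IsBackbone.measure_no_long_edge_le (hX : IsBackbone d N X) (hd : 0 < d) (hβ : 0 < β)
    (hs : 0 < s) (hU : IsUniformMarks P U) (K : Ω → ℕ) (Y : ℕ → Ω → Fin d → ℝ) {γ : ℝ} {i j : ℕ}
    (hi : i < latticeCard d N) (hj : j < latticeCard d N)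
    (hR : 2 * (supDist (X i) (X j) : ℝ) ^ γ < supDist (X i) (X j)) :
    P {ω | ¬ ∃ a < latticeCard d N, ∃ b < latticeCard d N,
      (supDist (X i) (X a) : ℝ) ≤ (supDist (X i) (X j) : ℝ) ^ γ ∧
      (supDist (X b) (X j) : ℝ) ≤ (supDist (X i) (X j) : ℝ) ^ γ ∧
      (graph d N β s X (K ω) (fun i => Y i ω) (fun e => U e ω)).Adj a b} ≤
      ENNReal.ofReal (Real.exp (-(β * (2 * d) ^ (-s) *
        (supDist (X i) (X j) : ℝ) ^ (2 * d * γ - s)))) := by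
  set R := supDist (X i) (X j) with hRdef
  have hRγ : 0 ≤ (R : ℝ) ^ γ := by positivity
  have hR0 : 0 < R := by
    have : (0 : ℝ) < R := by linarith
    exact_mod_cast this
  set r := ⌊(R : ℝ) ^ γ⌋₊ with hr
  have hr1 : (r : ℝ) ≤ (R : ℝ) ^ γ := Nat.floor_le hRγ
  have hr2 : (R : ℝ) ^ γ ≤ r + 1 := (Nat.lt_floor_add_one _).le
  have h2r : 2 * r < R := by
    have : (2 * r : ℝ) < R := by linarith
    exact_mod_cast this
  have hRN : R ≤ N := by
    refine supDist_le_iff.2 fun k => ?_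
    have := mem_latticeCube.1 (hX.mem_cube hi) k
    have := mem_latticeCube.1 (hX.mem_cube hj) k
    omega
  obtain ⟨Q, hQ, hQc⟩ := hX.exists_box_labels hi (r := r) (by omega)
  obtain ⟨Q', hQ', hQc'⟩ := hX.exists_box_labels hj (r := r) (by omega)
  have hdisj : Disjoint Q Q' := by
    refine Finset.disjoint_left.2 fun a ha ha' => ?_
    have h1 := (hQ a ha).2
    have h2 := (hQ' a ha').2
    have h3 := supDist_triangle (X i) (X a) (X j)
    rw [supDist_comm (X a)] at h3
    omega
  have ht : ∀ a ∈ Q, ∀ b ∈ Q', sumDist (X a) (X b) ≤ 2 * d * R := by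
    intro a ha b hb
    have h1 := (hQ a ha).2
    have h2 := (hQ' b hb).2
    have h3 := supDist_triangle (X a) (X i) (X b)
    have h4 := supDist_triangle (X i) (X j) (X b)
    rw [supDist_comm (X a) (X i)] at h3
    calc sumDist (X a) (X b) ≤ d * supDist (X a) (X b) := sumDist_le_mul_supDist _ _
      _ ≤ d * (2 * R) := Nat.mul_le_mul_left _ (by omega)
      _ = _ := by ring
  have hprob := hX.measure_no_edge_le hβ hs hU K Y (fun a ha => (hQ a ha).1)
    (fun b hb => (hQ' b hb).1) hdisj ht
  refine (measure_mono ?_).trans (hprob.trans ?_)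
  · intro ω hω a ha b hb hadj
    refine hω ⟨a, (hQ a ha).1, b, (hQ' b hb).1, ?_, ?_, hadj⟩
    · exact le_trans (by exact_mod_cast (hQ a ha).2) hr1
    · rw [supDist_comm]
      exact le_trans (by exact_mod_cast (hQ' b hb).2) hr1
  · rw [← ENNReal.ofReal_pow (Real.exp_pos _).le, ← Real.exp_nat_mul]
    refine ENNReal.ofReal_le_ofReal (Real.exp_le_exp.2 ?_)
    have hRpos : (0 : ℝ) < R := by exact_mod_cast hR0
    have hdpos : (0 : ℝ) < d := by exact_mod_cast hd
    have hcard : (R : ℝ) ^ (2 * d * γ) ≤ ((Q.card * Q'.card : ℕ) : ℝ) := by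
      have e : (R : ℝ) ^ (2 * d * γ) = (((R : ℝ) ^ γ) ^ d) * (((R : ℝ) ^ γ) ^ d) := by
        rw [← Real.rpow_natCast, ← Real.rpow_mul hRpos.le, ← Real.rpow_add hRpos]
        congr 1; ring
      have h1 : ((R : ℝ) ^ γ) ^ d ≤ Q.card :=
        (pow_le_pow_left₀ hRγ hr2 d).trans (by exact_mod_cast hQc)
      have h2 : ((R : ℝ) ^ γ) ^ d ≤ Q'.card :=
        (pow_le_pow_left₀ hRγ hr2 d).trans (by exact_mod_cast hQc')
      rw [e]
      push_cast
      exact mul_le_mul h1 h2 (by positivity) (by positivity)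
    have e2 : (((2 * d * R : ℕ) : ℝ)) ^ (-s) = (2 * d : ℝ) ^ (-s) * (R : ℝ) ^ (-s) := by
      push_cast
      rw [Real.mul_rpow (by positivity) hRpos.le]
    have e3 : (R : ℝ) ^ (2 * d * γ - s) = (R : ℝ) ^ (2 * d * γ) * (R : ℝ) ^ (-s) := by
      rw [← Real.rpow_add hRpos]; congr 1
    rw [e2, e3]
    have hc : 0 ≤ β * ((2 * d : ℝ) ^ (-s) * (R : ℝ) ^ (-s)) := by positivity
    nlinarith [mul_le_mul_of_nonneg_right hcard hc]

/-- With high probability, there is an edge between suitable neighbourhoods of any two lattice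
points that are far apart. -/
lemma IsBackbone.measure_exists_no_long_edge_le (hX : IsBackbone d N X) (hd : 0 < d) (hβ : 0 < β)
    (hs : 0 < s) (hU : IsUniformMarks P U) (K : Ω → ℕ) (Y : ℕ → Ω → Fin d → ℝ) {γ : ℝ} {R₀ : ℕ}
    (hγ : 0 ≤ 2 * d * γ - s) (hR₀ : ∀ R : ℕ, R₀ ≤ R → 2 * (R : ℝ) ^ γ < R) :
    P {ω | ∃ i < latticeCard d N, ∃ j < latticeCard d N, R₀ ≤ supDist (X i) (X j) ∧
      ¬ ∃ a < latticeCard d N, ∃ b < latticeCard d N,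
      (supDist (X i) (X a) : ℝ) ≤ (supDist (X i) (X j) : ℝ) ^ γ ∧
      (supDist (X b) (X j) : ℝ) ≤ (supDist (X i) (X j) : ℝ) ^ γ ∧
      (graph d N β s X (K ω) (fun i => Y i ω) (fun e => U e ω)).Adj a b} ≤
      ENNReal.ofReal ((N + 1) ^ d * (N + 1) ^ d *
        Real.exp (-(β * (2 * d) ^ (-s) * (R₀ : ℝ) ^ (2 * d * γ - s)))) := by
  classical
  let I := (Finset.range (latticeCard d N) ×ˢ Finset.range (latticeCard d N)).filter
    fun q => R₀ ≤ supDist (X q.1) (X q.2)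
  let A : ℕ × ℕ → Set Ω := fun q => {ω | ¬ ∃ a < latticeCard d N, ∃ b < latticeCard d N,
      (supDist (X q.1) (X a) : ℝ) ≤ (supDist (X q.1) (X q.2) : ℝ) ^ γ ∧
      (supDist (X b) (X q.2) : ℝ) ≤ (supDist (X q.1) (X q.2) : ℝ) ^ γ ∧
      (graph d N β s X (K ω) (fun i => Y i ω) (fun e => U e ω)).Adj a b}
  have hcard : (I.card : ℝ) ≤ (N + 1) ^ d * (N + 1) ^ d := by
    have : I.card ≤ (N + 1) ^ d * (N + 1) ^ d := by
      refine (Finset.card_filter_le _ _).trans ?_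
      rw [Finset.card_product, Finset.card_range, latticeCard]
    exact_mod_cast this
  refine (measure_mono (t := ⋃ q ∈ I, A q) ?_).trans ((measure_biUnion_finset_le _ _).trans ?_)
  · rintro ω ⟨i, hi, j, hj, hij, h⟩
    simp only [Set.mem_iUnion, exists_prop]
    refine ⟨(i, j), ?_, h⟩
    simp only [I, Finset.mem_filter, Finset.mem_product, Finset.mem_range]
    exact ⟨⟨hi, hj⟩, hij⟩
  · have hle : ∀ q ∈ I, P (A q) ≤ ENNReal.ofReal
        (Real.exp (-(β * (2 * d) ^ (-s) * (R₀ : ℝ) ^ (2 * d * γ - s)))) := by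
      rintro ⟨i, j⟩ hq
      simp only [I, Finset.mem_filter, Finset.mem_product, Finset.mem_range] at hq
      refine (hX.measure_no_long_edge_le hd hβ hs hU K Y hq.1.1 hq.1.2 (hR₀ _ hq.2)).trans
        (ENNReal.ofReal_le_ofReal (Real.exp_le_exp.2 (neg_le_neg ?_)))
      have : (R₀ : ℝ) ^ (2 * d * γ - s) ≤ (supDist (X i) (X j) : ℝ) ^ (2 * d * γ - s) :=
        Real.rpow_le_rpow (by positivity) (by exact_mod_cast hq.2) hγ
      exact mul_le_mul_of_nonneg_left this (by positivity)
    refine (Finset.sum_le_sum hle).trans ?_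
    rw [Finset.sum_const, nsmul_eq_mul, ← ENNReal.ofReal_natCast,
      ← ENNReal.ofReal_mul (by positivity)]
    exact ENNReal.ofReal_le_ofReal (mul_le_mul_of_nonneg_right hcard (Real.exp_pos _).le)

end LongEdges

/-! ### Hierarchical paths between lattice sites -/

section Hierarchy

variable {d N : ℕ} {X : ℕ → Fin d → ℤ} {G : SimpleGraph ℕ}

/-- A lattice geodesic inside the cube is followed, each unit step costing at most `D`. -/
lemma IsBackbone.edist_le_sumDist_mul (hX : IsBackbone d N X) {D : ℕ}
    (hD : ∀ i < latticeCard d N, ∀ j < latticeCard d N, sumDist (X i) (X j) = 1 →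
      G.edist i j ≤ D) {i j : ℕ} (hi : i < latticeCard d N) (hj : j < latticeCard d N) :
    G.edist i j ≤ (sumDist (X i) (X j) * D : ℕ) := by
  induction h : sumDist (X i) (X j) using Nat.strong_induction_on generalizing i with
  | _ n ih =>
    by_cases hne : X i = X j
    · rw [hX.injOn hi hj hne]; simp
    obtain ⟨z, hz, hiz, hzj⟩ := exists_step (hX.mem_cube hi) (hX.mem_cube hj) hne
    obtain ⟨l, hl, rfl⟩ := hX.exists_label hz
    have h1 := hD i hi l hl hiz
    have h2 := ih _ (by omega) hl rfl
    obtain ⟨n, rfl⟩ : ∃ n', n = n' + 1 := ⟨n - 1, by omega⟩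
    rw [show sumDist (X l) (X j) = n by omega] at h2
    calc G.edist i j ≤ G.edist i l + G.edist l j := SimpleGraph.edist_triangle
      _ ≤ (D : ℕ∞) + (n * D : ℕ) := add_le_add h1 h2
      _ = ((n + 1) * D : ℕ) := by push_cast; ring

/-- If any two far away lattice points have neighbourhoods of radius `(supDist _ _) ^ γ` that are
joined by an edge, then `k` subdivisions of a pair of points lead to the scale `R₀`. -/
lemma IsBackbone.edist_add_one_le (hX : IsBackbone d N X) {D R₀ : ℕ} {γ : ℝ} (hγ : 0 ≤ γ)
    (hD : ∀ i < latticeCard d N, ∀ j < latticeCard d N, sumDist (X i) (X j) = 1 →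
      G.edist i j ≤ D)
    (hlink : ∀ i < latticeCard d N, ∀ j < latticeCard d N, R₀ ≤ supDist (X i) (X j) →
      ∃ a < latticeCard d N, ∃ b < latticeCard d N,
      (supDist (X i) (X a) : ℝ) ≤ (supDist (X i) (X j) : ℝ) ^ γ ∧
      (supDist (X b) (X j) : ℝ) ≤ (supDist (X i) (X j) : ℝ) ^ γ ∧ G.Adj a b)
    (k : ℕ) {i j : ℕ} (hi : i < latticeCard d N) (hj : j < latticeCard d N)
    (hk : (supDist (X i) (X j) : ℝ) ^ (γ ^ k) < R₀) :
    G.edist i j + 1 ≤ (2 ^ k * (d * R₀ * D + 1) : ℕ) := by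
  have near : ∀ i < latticeCard d N, ∀ j < latticeCard d N, supDist (X i) (X j) < R₀ →
      G.edist i j + 1 ≤ (d * R₀ * D + 1 : ℕ) := by
    intro i hi j hj hij
    have h1 := hX.edist_le_sumDist_mul hD hi hj
    have h2 : sumDist (X i) (X j) * D ≤ d * R₀ * D :=
      Nat.mul_le_mul_right _ ((sumDist_le_mul_supDist _ _).trans (Nat.mul_le_mul_left _ hij.le))
    rw [Nat.cast_add, Nat.cast_one]
    exact add_le_add_left (h1.trans (by exact_mod_cast h2)) 1
  induction k generalizing i j with
  | zero =>
    simp only [pow_zero, Real.rpow_one, Nat.cast_lt] at hk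
    simpa using near i hi j hj hk
  | succ k ih =>
    by_cases hij : supDist (X i) (X j) < R₀
    · refine (near i hi j hj hij).trans ?_
      exact_mod_cast Nat.le_mul_of_pos_left _ (by positivity)
    · obtain ⟨a, ha, b, hb, hia, hbj, hab⟩ := hlink i hi j hj (not_lt.1 hij)
      -- Passing to a gap of size at most the γ-th power uses up one factor of γ in the exponent.
      have hpow : ∀ m : ℕ, (m : ℝ) ≤ (supDist (X i) (X j) : ℝ) ^ γ → (m : ℝ) ^ (γ ^ k) < R₀ := by
        intro m hm
        refine lt_of_le_of_lt (Real.rpow_le_rpow (by positivity) hm (pow_nonneg hγ k)) ?_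
        rwa [← Real.rpow_mul (by positivity), ← pow_succ']
      have h1 := ih hi ha (hpow _ hia)
      have h2 := ih hb hj (hpow _ hbj)
      have h3 : G.edist a b = 1 := SimpleGraph.edist_eq_one_iff_adj.2 hab
      -- The added one pays for the connecting edge: the quantity distance plus one exactly doubles.
      calc G.edist i j + 1 ≤ (G.edist i a + (G.edist a b + G.edist b j)) + 1 :=
            add_le_add_left (SimpleGraph.edist_triangle.trans
              (add_le_add_right SimpleGraph.edist_triangle _)) 1
        _ = (G.edist i a + 1) + (G.edist b j + 1) := by rw [h3]; ring
        _ ≤ _ := add_le_add h1 h2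
        _ = _ := by push_cast; ring

end Hierarchy

/-! ### Poisson points of a fixed configuration attach to the backbone -/

section Attachment

variable {d N : ℕ} {β s : ℝ} {X : ℕ → Fin d → ℤ}

/-- Every point of the cube is close to a lattice point of the cube that is different from it. -/
lemma IsBackbone.exists_near_label (hX : IsBackbone d N X) (hd : 0 < d) (hN : 0 < N)
    {z : Fin d → ℝ} (hz : z ∈ cube d N) : ∃ i < latticeCard d N,
      0 < oneNorm ((fun k => (X i k : ℝ)) - z) ∧ oneNorm ((fun k => (X i k : ℝ)) - z) ≤ d := by
  let w : Fin d → ℤ := fun k => ⌊z k⌋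
  have hz0 : ∀ k, 0 ≤ z k := fun k => hz.1 k
  have hz1 : ∀ k, z k ≤ N := fun k => hz.2 k
  have hw : w ∈ latticeCube d N := mem_latticeCube.2 fun k =>
    ⟨Int.floor_nonneg.2 (hz0 k), by
      have : (⌊z k⌋ : ℝ) ≤ (N : ℤ) := (Int.floor_le _).trans (by simpa using hz1 k)
      exact_mod_cast this⟩
  -- The site must differ from `z`: by the convention for powers of zero, the connection function
  -- vanishes at distance zero. If `z` is itself a lattice point, one coordinate is shifted by one.
  by_cases h : ∃ k, (w k : ℝ) ≠ z k
  · obtain ⟨k, hk⟩ := h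
    obtain ⟨i, hi, hiw⟩ := hX.exists_label hw
    refine ⟨i, hi, ?_, ?_⟩
    · rw [hiw]
      refine Finset.sum_pos' (fun _ _ => abs_nonneg _) ⟨k, Finset.mem_univ k, ?_⟩
      simpa [sub_eq_zero] using hk
    · rw [hiw]
      calc oneNorm ((fun k => (w k : ℝ)) - z) ≤ ∑ _k : Fin d, (1 : ℝ) := by
            refine Finset.sum_le_sum fun k _ => ?_
            simp only [Pi.sub_apply, w]
            rw [abs_le]
            constructor <;> linarith [Int.floor_le (z k), Int.lt_floor_add_one (z k)]
        _ = d := by simp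
  · push Not at h
    have hzw : z = fun k => (w k : ℝ) := funext fun k => (h k).symm
    have hw0 := mem_latticeCube.1 hw ⟨0, hd⟩
    obtain ⟨c, hc0, hc1, hc⟩ : ∃ c : ℤ, 0 ≤ c ∧ c ≤ N ∧ (w ⟨0, hd⟩ - c).natAbs = 1 := by
      by_cases hlt : w ⟨0, hd⟩ < N
      · exact ⟨w ⟨0, hd⟩ + 1, by omega, by omega, by omega⟩
      · exact ⟨w ⟨0, hd⟩ - 1, by omega, by omega, by omega⟩
    obtain ⟨i, hi, hiw⟩ := hX.exists_label (z := Function.update w ⟨0, hd⟩ c)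
      (mem_latticeCube.2 fun k => by
        by_cases hk : k = ⟨0, hd⟩
        · subst hk; simpa using ⟨hc0, hc1⟩
        · rw [Function.update_of_ne hk]; exact mem_latticeCube.1 hw k)
    have hone : oneNorm ((fun k => (X i k : ℝ)) - z) = 1 := by
      rw [hzw, oneNorm_lattice_sub, hiw, sumDist_comm, sumDist_update_self, hc]
      simp
    refine ⟨i, hi, ?_, ?_⟩ <;> rw [hone]
    · exact one_pos
    · exact_mod_cast hd

variable {Ω : Type*} [MeasurableSpace Ω] {P : Measure Ω} {U : Sym2 ℕ → Ω → ℝ}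

/-- A point of a given configuration that is joined to the backbone is unlikely to have a large
graph distance from the backbone. -/
lemma IsBackbone.measure_far_from_backbone_le (hX : IsBackbone d N X) (hd : 0 < d) (hN : 0 < N)
    (hβ : 0 < β) (hs : 0 < s) (hU : IsUniformMarks P U) {k : ℕ} {y : ℕ → Fin d → ℝ}
    (hy : ∀ i < k, y i ∈ cube d N) (L : ℕ) {j : ℕ} (hj : latticeCard d N ≤ j)
    (hjk : j < latticeCard d N + k) :
    P {ω | (graph d N β s X k y fun e => U e ω).Reachable j 0 ∧ ∀ i < latticeCard d N,
      ¬ (graph d N β s X k y fun e => U e ω).edist j i ≤ L} ≤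
      ENNReal.ofReal (Real.exp (-β * (d : ℝ) ^ (-s))) ^ L := by
  classical
  set Z := latticeCard d N with hZ
  have hZ0 : 0 < Z := by rw [hZ, latticeCard]; positivity
  set g := threshold d N β s X y with hg
  let I : Finset ℕ := Finset.Ico Z (Z + k)
  -- Only pairs of Poisson points are explored, so the marks of pairs with a backbone site remain
  -- fresh.
  let E : Finset (Sym2 ℕ) := (I ×ˢ I).image fun q => s(q.1, q.2)
  have hE : ∀ a b, s(a, b) ∈ E ↔ a ∈ I ∧ b ∈ I := by
    intro a b
    simp only [E, Finset.mem_image, Finset.mem_product, Prod.exists, Sym2.eq_iff]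
    constructor
    · rintro ⟨a', b', ⟨ha, hb⟩, ⟨rfl, rfl⟩ | ⟨rfl, rfl⟩⟩
      exacts [⟨ha, hb⟩, ⟨hb, ha⟩]
    · exact fun h => ⟨a, b, h, Or.inl ⟨rfl, rfl⟩⟩
  have hatt : ∀ t, ∃ i, t ∈ I → i < Z ∧
      0 < oneNorm (position d N X y i - position d N X y t) ∧
      oneNorm (position d N X y i - position d N X y t) ≤ d := by
    intro t
    by_cases ht : t ∈ I
    · have ht' := Finset.mem_Ico.1 ht
      obtain ⟨i, hi, h⟩ := hX.exists_near_label hd hN (hy (t - Z) (by omega))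
      refine ⟨i, fun _ => ⟨hi, ?_⟩⟩
      rw [position_of_lt hi, position, if_neg (by omega)]
      exact h
    · exact ⟨0, fun h => absurd h ht⟩
  choose att hatt using hatt
  -- The exploration finds `L` Poisson points within distance `L - 1` of `j`; the spare unit is for
  -- the edge to the backbone. The witness is chosen from `O` alone, so `T` does not look at the
  -- fresh marks.
  let good : Finset (Sym2 ℕ) → Prop := fun O => ∃ V : Finset ℕ, V.card = L ∧ ∀ v ∈ V, v ∈ I ∧
    (SimpleGraph.fromEdgeSet (O : Set (Sym2 ℕ))).edist j v + 1 ≤ L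
  let T : Finset (Sym2 ℕ) → Finset (Sym2 ℕ) := fun O =>
    if h : good O then h.choose.image fun v => s(att v, v) else ∅
  have hT : ∀ O (h : good O), T O = h.choose.image fun v => s(att v, v) := fun O h => dif_pos h
  have hattI : ∀ v ∈ I, att v ∉ I := fun v hv h => by
    have := (hatt v hv).1
    have := Finset.mem_Ico.1 h
    omega
  refine (measure_mono ?_).trans (hU.measure_forall_mem_choice_le (g := g) (E := E) (T := T)
    (good := good) (θ := Real.exp (-β * (d : ℝ) ^ (-s))) (fun e => threshold_nonneg hβ e)
    (fun e => threshold_le_one e) ?_ ?_ ?_)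
  · rintro ω ⟨hreach, hfar⟩
    set G := graph d N β s X k y fun e => U e ω with hG
    set O := openSet g E fun e => U e ω with hO
    have hHG : SimpleGraph.fromEdgeSet (O : Set (Sym2 ℕ)) ≤ G := by
      intro a b hab
      rw [SimpleGraph.fromEdgeSet_adj, Finset.mem_coe, mem_openSet, hE] at hab
      obtain ⟨⟨⟨ha, hb⟩, hle⟩, hne⟩ := hab
      exact graph_adj_iff.2 ⟨hne, (Finset.mem_Ico.1 ha).2, (Finset.mem_Ico.1 hb).2, Or.inr hle⟩
    have hgood : good O := by
      obtain ⟨p, hp, hlen⟩ := hreach.exists_path_of_dist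
      have hLlen : L < p.length := by
        by_contra hle
        refine hfar 0 hZ0 ((SimpleGraph.edist_le p).trans ?_)
        exact_mod_cast not_lt.1 hle
      -- A backbone site among the first vertices of the path would be within distance `L` of `j`,
      -- so the path to the origin begins with Poisson points only.
      have hmem : ∀ m ≤ L, p.getVert m ∈ I := by
        intro m hm
        refine Finset.mem_Ico.2 ⟨?_, ?_⟩
        · by_contra hlt
          refine hfar _ (not_le.1 hlt) ((SimpleGraph.edist_le (p.take m)).trans ?_)
          rw [SimpleGraph.Walk.take_length]
          exact_mod_cast (min_le_left _ _).trans hm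
        · exact (graph_adj_iff.1 (p.adj_getVert_succ (i := m) (by omega))).2.1
      have hdist : ∀ m ≤ L,
          (SimpleGraph.fromEdgeSet (O : Set (Sym2 ℕ))).edist j (p.getVert m) ≤ m := by
        intro m
        induction m with
        | zero => intro _; simp
        | succ m ih =>
          intro hm
          have hadj := p.adj_getVert_succ (i := m) (by omega)
          have h1 := Finset.mem_Ico.1 (hmem m (by omega))
          have hadj' : (SimpleGraph.fromEdgeSet (O : Set (Sym2 ℕ))).Adj (p.getVert m)
              (p.getVert (m + 1)) := by
            rw [SimpleGraph.fromEdgeSet_adj, Finset.mem_coe, mem_openSet, hE]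
            refine ⟨⟨⟨hmem m (by omega), hmem (m + 1) hm⟩, ?_⟩, hadj.ne⟩
            rcases (graph_adj_iff.1 hadj).2.2.2 with h | h
            · omega
            · exact h
          refine (SimpleGraph.edist_triangle (v := p.getVert m)).trans ?_
          rw [SimpleGraph.edist_eq_one_iff_adj.2 hadj']
          push_cast
          exact add_le_add_left (ih (by omega)) 1
      refine ⟨(Finset.range L).image p.getVert, ?_, ?_⟩
      · rw [Finset.card_image_of_injOn, Finset.card_range]
        refine hp.getVert_injOn.mono fun m hm => ?_
        have := Finset.mem_range.1 (Finset.mem_coe.1 hm)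
        show m ≤ p.length
        omega
      · intro v hv
        obtain ⟨m, hm, rfl⟩ := Finset.mem_image.1 hv
        have hm' := Finset.mem_range.1 hm
        refine ⟨hmem m hm'.le, (add_le_add_left (hdist m hm'.le) 1).trans ?_⟩
        exact_mod_cast hm'
    refine ⟨hgood, fun e he => ?_⟩
    rw [hT O hgood] at he
    obtain ⟨v, hv, rfl⟩ := Finset.mem_image.1 he
    obtain ⟨hvI, hvd⟩ := hgood.choose_spec.2 v hv
    -- A single open pair between an explored point and its site would put `j` within distance `L`
    -- of the backbone.
    by_contra hle
    have hvI' := Finset.mem_Ico.1 hvI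
    have hav := (hatt v hvI).1
    have hadj : G.Adj v (att v) := by
      refine (graph_adj_iff.2 ⟨by omega, by omega, hvI'.2, Or.inr (not_lt.1 hle)⟩ :
        G.Adj (att v) v).symm
    refine hfar (att v) hav ((SimpleGraph.edist_triangle (v := v)).trans (le_trans ?_ hvd))
    rw [SimpleGraph.edist_eq_one_iff_adj.2 hadj]
    exact add_le_add_left (SimpleGraph.edist_anti hHG) 1
  · intro O h
    rw [hT O h]
    refine Finset.disjoint_left.2 fun e he he' => ?_
    obtain ⟨v, hv, rfl⟩ := Finset.mem_image.1 he'
    exact hattI v (h.choose_spec.2 v hv).1 ((hE _ _).1 he).1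
  · intro O h
    rw [hT O h, Finset.card_image_of_injOn, h.choose_spec.1]
    intro v hv w hw hvw
    rcases Sym2.eq_iff.1 hvw with ⟨_, h2⟩ | ⟨h1, _⟩
    · exact h2
    · exact absurd (h1 ▸ (h.choose_spec.2 w hw).1) (hattI v (h.choose_spec.2 v hv).1)
  · intro O h e he
    rw [hT O h] at he
    obtain ⟨v, hv, rfl⟩ := Finset.mem_image.1 he
    obtain ⟨_, h1, h2⟩ := hatt v (h.choose_spec.2 v hv).1
    exact one_sub_connProb_le hβ hs h1 h2

end Attachment

/-! ### Measurability of distance and connection events -/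

section Measurability

/-- First-step recursion, which builds distance events from adjacency events by countable set
operations. -/
lemma edist_le_add_one_iff {V : Type*} {G : SimpleGraph V} {a b : V} {n : ℕ} :
    G.edist a b ≤ (n + 1 : ℕ) ↔ G.edist a b ≤ n ∨ ∃ c, G.Adj a c ∧ G.edist c b ≤ n := by
  constructor
  · intro h
    by_cases hn : G.edist a b ≤ n
    · exact Or.inl hn
    right
    obtain ⟨p, hp⟩ := SimpleGraph.exists_walk_of_edist_ne_top (ne_top_of_le_ne_top
      (ENat.natCast_ne_top _) h)
    cases p with
    | nil => simp at hn
    | @cons _ c _ hadj q =>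
      refine ⟨c, hadj, (SimpleGraph.edist_le q).trans ?_⟩
      rw [← hp, SimpleGraph.Walk.length_cons] at h
      have : q.length + 1 ≤ n + 1 := by exact_mod_cast h
      exact_mod_cast (by omega : q.length ≤ n)
  · rintro (h | ⟨c, hc, h⟩)
    · exact h.trans (by exact_mod_cast Nat.le_succ n)
    · refine (SimpleGraph.edist_triangle (v := c)).trans ?_
      rw [SimpleGraph.edist_eq_one_iff_adj.2 hc, add_comm]
      push_cast
      exact add_le_add_left h 1

variable {d N : ℕ} {β s : ℝ} {X : ℕ → Fin d → ℤ}

/-- The graph as a function of the random data. -/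
noncomputable def dataGraph (d N : ℕ) (β s : ℝ) (X : ℕ → Fin d → ℤ)
    (z : (ℕ × (ℕ → Fin d → ℝ)) × (Sym2 ℕ → ℝ)) : SimpleGraph ℕ :=
  graph d N β s X z.1.1 z.1.2 z.2

lemma measurable_threshold (e : Sym2 ℕ) :
    Measurable fun y : ℕ → Fin d → ℝ => threshold d N β s X y e := by
  have hpos : ∀ i, Measurable fun y : ℕ → Fin d → ℝ => position d N X y i := by
    intro i
    unfold position
    split_ifs
    · exact measurable_const
    · exact measurable_pi_apply _
  induction e using Sym2.ind with
  | _ i j =>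
    simp only [threshold_mk, connProb, oneNorm]
    have h : ∀ k, Measurable fun y : ℕ → Fin d → ℝ =>
        |(position d N X y i - position d N X y j) k| := fun k => by
      have := (measurable_pi_apply k).comp ((hpos i).sub (hpos j))
      exact this.abs
    exact measurable_const.sub (Real.measurable_exp.comp
      (((Finset.measurable_fun_sum _ fun k _ => h k).pow_const _).const_mul _))

lemma measurableSet_dataGraph_adj (a b : ℕ) :
    MeasurableSet {z | (dataGraph d N β s X z).Adj a b} := by
  simp only [dataGraph, graph_adj_iff]
  have hk : Measurable fun z : (ℕ × (ℕ → Fin d → ℝ)) × (Sym2 ℕ → ℝ) => z.1.1 := by fun_prop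
  have hlt : ∀ c, MeasurableSet {z : (ℕ × (ℕ → Fin d → ℝ)) × (Sym2 ℕ → ℝ) |
      c < latticeCard d N + z.1.1} := fun c =>
    hk (MeasurableSet.of_discrete (s := {k | c < latticeCard d N + k}))
  have hU : Measurable fun z : (ℕ × (ℕ → Fin d → ℝ)) × (Sym2 ℕ → ℝ) => z.2 s(a, b) :=
    (measurable_pi_apply _).comp measurable_snd
  have hg : Measurable fun z : (ℕ × (ℕ → Fin d → ℝ)) × (Sym2 ℕ → ℝ) =>
      threshold d N β s X z.1.2 s(a, b) := (measurable_threshold _).comp (by fun_prop)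
  exact (MeasurableSet.const _).inter ((hlt a).inter ((hlt b).inter
    ((MeasurableSet.const _).union (measurableSet_le hU hg))))

lemma measurableSet_dataGraph_edist_le (a b n : ℕ) :
    MeasurableSet {z | (dataGraph d N β s X z).edist a b ≤ n} := by
  induction n generalizing a with
  | zero => simp only [Nat.cast_zero, nonpos_iff_eq_zero, SimpleGraph.edist_eq_zero_iff]; simp
  | succ n ih =>
    simp only [edist_le_add_one_iff]
    have h : MeasurableSet {z | ∃ c, (dataGraph d N β s X z).Adj a c ∧
        (dataGraph d N β s X z).edist c b ≤ n} := by
      rw [show {z | ∃ c, (dataGraph d N β s X z).Adj a c ∧ (dataGraph d N β s X z).edist c b ≤ n} =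
        ⋃ c, ({z | (dataGraph d N β s X z).Adj a c} ∩
          {z | (dataGraph d N β s X z).edist c b ≤ n}) by ext; simp]
      exact MeasurableSet.iUnion fun c => (measurableSet_dataGraph_adj a c).inter (ih c)
    exact (ih a).union h

lemma measurableSet_dataGraph_reachable (a b : ℕ) :
    MeasurableSet {z | (dataGraph d N β s X z).Reachable a b} := by
  rw [show {z | (dataGraph d N β s X z).Reachable a b} =
      ⋃ n : ℕ, {z | (dataGraph d N β s X z).edist a b ≤ n} from ?_]
  · exact MeasurableSet.iUnion fun n => measurableSet_dataGraph_edist_le a b n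
  · ext z
    simp only [Set.mem_ofPred_eq, Set.mem_iUnion]
    constructor
    · rintro ⟨w⟩
      exact ⟨_, SimpleGraph.edist_le w⟩
    · rintro ⟨n, hn⟩
      exact SimpleGraph.reachable_of_edist_ne_top (ne_top_of_le_ne_top (ENat.natCast_ne_top _) hn)

end Measurability

/-! ### Averaging over the Poisson points -/

section PoissonPoints

/-- The weights p_n satisfy (n + 1) p_{n+1} = r p_n, and they sum to one. -/
lemma lintegral_poissonMeasure_id_le (r : ℝ≥0) : ∫⁻ n : ℕ, (n : ℝ≥0∞) ∂(poissonMeasure r) ≤ r := by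
  have hone : ∑' n : ℕ, poissonMeasure r {n} = 1 := by
    have h := lintegral_countable' (μ := poissonMeasure r) (fun _ : ℕ => (1 : ℝ≥0∞))
    simpa using h.symm
  rw [lintegral_countable', tsum_eq_zero_add' ENNReal.summable]
  have hterm : ∀ n : ℕ, ((n + 1 : ℕ) : ℝ≥0∞) * poissonMeasure r {n + 1} =
      r * poissonMeasure r {n} := by
    intro n
    rw [poissonMeasure_singleton, poissonMeasure_singleton, ← ENNReal.ofReal_natCast,
      ← ENNReal.ofReal_mul (by positivity), ← ENNReal.ofReal_coe_nnreal,
      ← ENNReal.ofReal_mul (by positivity)]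
    congr 1
    rw [Nat.factorial_succ, pow_succ]
    push_cast
    field_simp
  simp only [hterm, Nat.cast_zero, zero_mul, zero_add, ENNReal.tsum_mul_left, hone, mul_one]
  exact le_rfl

variable {d N : ℕ} {β s ρ : ℝ} {X : ℕ → Fin d → ℤ}
  {Ω : Type*} [MeasurableSpace Ω] {P : Measure Ω} {K : Ω → ℕ} {Y : ℕ → Ω → Fin d → ℝ}
  {U : Sym2 ℕ → Ω → ℝ}

lemma measurableSet_cube : MeasurableSet (cube d N) := measurableSet_Icc

lemma volume_cube : volume (cube d N) = ENNReal.ofReal ((N : ℝ) ^ d) := by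
  rw [cube, show (0 : Fin d → ℝ) = fun _ => 0 from rfl, Real.volume_Icc_pi]
  simp [ENNReal.ofReal_pow]

/-- All points lie in the window, so `K` is the point count of the whole cube and has a Poisson law.
-/
lemma IsPoissonProcess.lintegral_card_le (hY : IsPoissonProcess P ρ (cube d N) K Y) (hρ : 0 < ρ) :
    ∫⁻ ω, (K ω : ℝ≥0∞) ∂P ≤ ENNReal.ofReal (ρ * (N : ℝ) ^ d) := by
  have hK : (fun ω => pointCount (K ω) (fun i => Y i ω) (cube d N)) = K := by
    classical
    funext ω
    rw [pointCount, Finset.filter_true_of_mem, Finset.card_range]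
    exact fun i hi => hY.mem_window ω i (Finset.mem_range.1 hi)
  have h := hY.poisson (cube d N) subset_rfl measurableSet_cube
  rw [hK] at h
  have h2 := lintegral_poissonMeasure_id_le (ρ.toNNReal * (volume (cube d N)).toNNReal)
  rw [← h, lintegral_map (by fun_prop) hY.measurable_card] at h2
  refine h2.trans (le_of_eq ?_)
  rw [ENNReal.coe_mul, volume_cube, ENNReal.coe_toNNReal ENNReal.ofReal_ne_top,
    ENNReal.ofReal_mul hρ.le]
  rfl

/-- With high probability, all Poisson points in the cluster of the origin have a small graph
distance from the backbone. -/
lemma IsBackbone.measure_exists_far_from_backbone_le [IsProbabilityMeasure P]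
    (hX : IsBackbone d N X) (hd : 0 < d) (hN : 0 < N) (hβ : 0 < β) (hs : 0 < s) (hρ : 0 < ρ)
    (hM : IsModel d N P ρ K Y U) (L : ℕ) :
    P {ω | ∃ j, latticeCard d N ≤ j ∧ j < latticeCard d N + K ω ∧
      (graph d N β s X (K ω) (fun i => Y i ω) fun e => U e ω).Reachable j 0 ∧
      ∀ i < latticeCard d N,
        ¬ (graph d N β s X (K ω) (fun i => Y i ω) fun e => U e ω).edist j i ≤ L} ≤
      ENNReal.ofReal (ρ * (N : ℝ) ^ d * Real.exp (-β * (d : ℝ) ^ (-s)) ^ L) := by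
  set Z := latticeCard d N with hZ
  set θ := ENNReal.ofReal (Real.exp (-β * (d : ℝ) ^ (-s))) ^ L with hθ
  let W : Ω → ℕ × (ℕ → Fin d → ℝ) := fun ω => (K ω, fun i => Y i ω)
  let V : Ω → Sym2 ℕ → ℝ := fun ω e => U e ω
  have hW : Measurable W := hM.points.measurable_card.prodMk
    (measurable_pi_lambda _ hM.points.measurable_point)
  have hV : Measurable V := measurable_pi_lambda _ hM.marks.measurable_mark
  let far : ℕ → Set ((ℕ × (ℕ → Fin d → ℝ)) × (Sym2 ℕ → ℝ)) := fun j =>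
    {z | (dataGraph d N β s X z).Reachable j 0 ∧
      ∀ i < Z, ¬ (dataGraph d N β s X z).edist j i ≤ L}
  -- The points are required to lie in the window, so that every nonempty fibre of `S` is covered by
  -- the bound for fixed configurations.
  let S : Set ((ℕ × (ℕ → Fin d → ℝ)) × (Sym2 ℕ → ℝ)) :=
    {z | (∀ i < z.1.1, z.1.2 i ∈ cube d N) ∧ ∃ j, Z ≤ j ∧ j < Z + z.1.1 ∧ z ∈ far j}
  have hfar : ∀ j, MeasurableSet (far j) := by
    intro j
    have h : MeasurableSet {z | ∀ i < Z, ¬ (dataGraph d N β s X z).edist j i ≤ L} := by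
      rw [show {z | ∀ i < Z, ¬ (dataGraph d N β s X z).edist j i ≤ L} =
        ⋂ i ∈ Finset.range Z, {z | (dataGraph d N β s X z).edist j i ≤ L}ᶜ by ext; simp]
      exact Finset.measurableSet_biInter _ fun i _ =>
        (measurableSet_dataGraph_edist_le j i L).compl
    exact (measurableSet_dataGraph_reachable j 0).inter h
  have hk : Measurable fun z : (ℕ × (ℕ → Fin d → ℝ)) × (Sym2 ℕ → ℝ) => z.1.1 := by fun_prop
  have hS : MeasurableSet S := by
    have h1 : MeasurableSet {z : (ℕ × (ℕ → Fin d → ℝ)) × (Sym2 ℕ → ℝ) |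
        ∀ i < z.1.1, z.1.2 i ∈ cube d N} := by
      rw [show {z : (ℕ × (ℕ → Fin d → ℝ)) × (Sym2 ℕ → ℝ) | ∀ i < z.1.1, z.1.2 i ∈ cube d N} =
        ⋂ i : ℕ, ({z | i < z.1.1}ᶜ ∪ {z | z.1.2 i ∈ cube d N}) by
          ext; simp [imp_iff_not_or]]
      refine MeasurableSet.iInter fun i => MeasurableSet.union
        (hk (MeasurableSet.of_discrete (s := {k | i < k}))).compl ?_
      have : Measurable fun z : (ℕ × (ℕ → Fin d → ℝ)) × (Sym2 ℕ → ℝ) => z.1.2 i :=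
        (measurable_pi_apply i).comp (by fun_prop)
      exact this measurableSet_cube
    have h2 : MeasurableSet {z | ∃ j, Z ≤ j ∧ j < Z + z.1.1 ∧ z ∈ far j} := by
      rw [show {z | ∃ j, Z ≤ j ∧ j < Z + z.1.1 ∧ z ∈ far j} =
        ⋃ j : ℕ, ({z | Z ≤ j} ∩ ({z | j < Z + z.1.1} ∩ far j)) by ext; simp]
      exact MeasurableSet.iUnion fun j => (MeasurableSet.const _).inter
        ((hk (MeasurableSet.of_discrete (s := {k | j < Z + k}))).inter (hfar j))
    exact h1.inter h2
  have hfiber : ∀ w : ℕ × (ℕ → Fin d → ℝ), P.map V (Prod.mk w ⁻¹' S) ≤ w.1 * θ := by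
    rintro ⟨k, y⟩
    rw [Measure.map_apply hV (measurable_prodMk_left hS)]
    by_cases hy : ∀ i < k, y i ∈ cube d N
    · refine (measure_mono (t := ⋃ j ∈ Finset.Ico Z (Z + k), {ω | (graph d N β s X k y
        fun e => U e ω).Reachable j 0 ∧ ∀ i < Z,
        ¬ (graph d N β s X k y fun e => U e ω).edist j i ≤ L}) ?_).trans
        ((measure_biUnion_finset_le _ _).trans ?_)
      · rintro ω ⟨-, j, h1, h2, h3⟩
        simp only [Set.mem_iUnion, exists_prop]
        exact ⟨j, Finset.mem_Ico.2 ⟨h1, h2⟩, h3⟩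
      · refine (Finset.sum_le_sum fun j hj => hX.measure_far_from_backbone_le hd hN hβ hs
          hM.marks hy L (Finset.mem_Ico.1 hj).1 (Finset.mem_Ico.1 hj).2).trans ?_
        simp [hθ]
    · rw [show V ⁻¹' (Prod.mk (k, y) ⁻¹' S) = ∅ from
        Set.eq_empty_of_forall_notMem fun ω h => hy h.1, measure_empty]
      exact zero_le
  have hsub : {ω | ∃ j, Z ≤ j ∧ j < Z + K ω ∧
      (graph d N β s X (K ω) (fun i => Y i ω) fun e => U e ω).Reachable j 0 ∧
      ∀ i < Z, ¬ (graph d N β s X (K ω) (fun i => Y i ω) fun e => U e ω).edist j i ≤ L} ⊆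
      (fun ω => (W ω, V ω)) ⁻¹' S := by
    rintro ω ⟨j, h1, h2, h3⟩
    exact ⟨hM.points.mem_window ω, j, h1, h2, h3⟩
  refine (measure_mono hsub).trans ?_
  -- Points and marks are independent, so their joint law is a product. Fubini turns the fibre
  -- bound, number of points times θ, into the mean number of points times θ.
  rw [← Measure.map_apply (hW.prodMk hV) hS,
    (indepFun_iff_map_prod_eq_prod_map_map hW.aemeasurable hV.aemeasurable).1 hM.indep]
  have : IsProbabilityMeasure (P.map V) := Measure.isProbabilityMeasure_map hV.aemeasurable
  rw [Measure.prod_apply hS]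
  calc ∫⁻ w, P.map V (Prod.mk w ⁻¹' S) ∂(P.map W) ≤ ∫⁻ w, w.1 * θ ∂(P.map W) :=
        lintegral_mono hfiber
    _ = ∫⁻ ω, K ω * θ ∂P := lintegral_map (by fun_prop) hW
    _ = (∫⁻ ω, (K ω : ℝ≥0∞) ∂P) * θ := lintegral_mul_const _
        (measurable_of_countable (fun n : ℕ => (n : ℝ≥0∞)) |>.comp hM.points.measurable_card)
    _ ≤ ENNReal.ofReal (ρ * (N : ℝ) ^ d) * θ := by
        gcongr
        exact hM.points.lintegral_card_le hρ
    _ = _ := by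
        rw [hθ, ← ENNReal.ofReal_pow (Real.exp_pos _).le, ← ENNReal.ofReal_mul (by positivity)]

end PoissonPoints

/-! ### From distances to the diameter of the cluster -/

section Diameter

variable {d N : ℕ} {β s : ℝ} {X : ℕ → Fin d → ℤ} {K : ℕ} {Y : ℕ → Fin d → ℝ} {U : Sym2 ℕ → ℝ}

/-- Two vertices of the cluster are joined by way of nearby backbone vertices: at most L, then M,
then L steps. -/
lemma clusterDiam_graph_le {L M : ℕ}
    (hM : ∀ i < latticeCard d N, ∀ j < latticeCard d N, (graph d N β s X K Y U).edist i j ≤ M)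
    (hL : ∀ j, latticeCard d N ≤ j → j < latticeCard d N + K →
      (graph d N β s X K Y U).Reachable j 0 →
      ∃ i < latticeCard d N, (graph d N β s X K Y U).edist j i ≤ L) :
    clusterDiam (graph d N β s X K Y U) 0 ≤ (2 * L + M : ℕ) := by
  set G := graph d N β s X K Y U with hG
  have hZ : 0 < latticeCard d N := by rw [latticeCard]; positivity
  have near : ∀ x, G.Reachable 0 x → ∃ i < latticeCard d N, G.edist x i ≤ L := by
    intro x hx
    by_cases hxZ : x < latticeCard d N
    · exact ⟨x, hxZ, by simp⟩
    · refine hL x (not_lt.1 hxZ) ?_ hx.symm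
      -- Labels beyond the vertex set are isolated, so a non-backbone label in the cluster is a
      -- Poisson point.
      obtain ⟨w⟩ := hx.symm
      cases w with
      | nil => omega
      | cons h _ => exact (graph_adj_iff.1 h).2.1
  refine iSup₂_le fun x hx => iSup₂_le fun y hy => ?_
  obtain ⟨i, hi, hxi⟩ := near x hx
  obtain ⟨j, hj, hyj⟩ := near y hy
  rw [SimpleGraph.edist_comm] at hyj
  calc G.edist x y ≤ G.edist x i + (G.edist i j + G.edist j y) :=
        SimpleGraph.edist_triangle.trans (add_le_add_right SimpleGraph.edist_triangle _)
    _ ≤ L + (M + L) := add_le_add hxi (add_le_add (hM i hi j hj) hyj)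
    _ = (2 * L + M : ℕ) := by push_cast; ring

end Diameter

/-! ### Asymptotics of the polylogarithmic scales -/

section Scales

open Filter Real

/-- The number of subdivisions needed to reach a bounded scale from the scale `exp x`. -/
noncomputable def subdivisions (γ x : ℝ) : ℕ := ⌈log x / -log γ⌉₊

lemma pow_subdivisions_mul_le {γ x : ℝ} (h0 : 0 < γ) (h1 : γ < 1) (hx : 1 ≤ x) :
    γ ^ subdivisions γ x * x ≤ 1 := by
  have hη : 0 < -log γ := by linarith [log_neg h0 h1]
  have hk : log x / -log γ ≤ subdivisions γ x := Nat.le_ceil _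
  rw [div_le_iff₀ hη] at hk
  have hx0 : 0 < x := by linarith
  have : γ ^ subdivisions γ x * x = exp (log γ * subdivisions γ x + log x) := by
    rw [exp_add, exp_log hx0, mul_comm (log γ), exp_nat_mul, exp_log h0]
  rw [this]
  exact exp_le_one_iff.2 (by linarith)

/-- Rounding up costs at most one subdivision, hence the factor 2; without it, 2^{log x / (-log γ)}
is exactly this power of x. -/
lemma two_pow_subdivisions_le {γ x : ℝ} (h0 : 0 < γ) (h1 : γ < 1) (hx : 1 ≤ x) :
    (2 : ℝ) ^ subdivisions γ x ≤ 2 * x ^ (log 2 / -log γ) := by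
  have hη : 0 < -log γ := by linarith [log_neg h0 h1]
  have hx0 : 0 < x := by linarith
  have hk : (subdivisions γ x : ℝ) ≤ log x / -log γ + 1 :=
    (Nat.ceil_lt_add_one (div_nonneg (log_nonneg hx) hη.le)).le
  calc (2 : ℝ) ^ subdivisions γ x = (2 : ℝ) ^ (subdivisions γ x : ℝ) := (rpow_natCast _ _).symm
    _ ≤ (2 : ℝ) ^ (log x / -log γ + 1) := rpow_le_rpow_of_exponent_le (by norm_num) hk
    _ = 2 * x ^ (log 2 / -log γ) := by
      rw [rpow_add two_pos, rpow_one, mul_comm, rpow_def_of_pos two_pos, rpow_def_of_pos hx0]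
      congr 2
      ring

/-- A product of polylogarithmic scales is polylogarithmic. -/
lemma eventually_scales_le (d : ℕ) {a b γ : ℝ} (ha : 0 ≤ a) (hb : 0 ≤ b) (h0 : 0 < γ)
    (h1 : γ < 1) : ∀ᶠ x : ℝ in atTop,
      2 * (⌈x ^ a⌉₊ : ℝ) + 2 ^ subdivisions γ x *
        (d * ⌈x ^ b⌉₊ * (2 * ⌈x ^ a⌉₊ + 1) ^ d + 1) ≤
      x ^ (log 2 / -log γ + b + a * d + a + 1) := by
  have hη : 0 < -log γ := by linarith [log_neg h0 h1]
  set κ := log 2 / -log γ with hκ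
  have hκ0 : 0 ≤ κ := div_nonneg (log_nonneg (by norm_num)) hη.le
  -- The second lower bound on x lets the extra 1 in the exponent absorb all constants.
  filter_upwards [eventually_ge_atTop 1, eventually_ge_atTop (4 + 2 * (d * 2 * 5 ^ d + 1) : ℝ)]
    with x hx hxA
  have hx0 : 0 < x := by linarith
  have ceil_le : ∀ e : ℝ, 0 ≤ e → (⌈x ^ e⌉₊ : ℝ) ≤ 2 * x ^ e := by
    intro e he
    have h1 := one_le_rpow hx he
    have h2 := (Nat.ceil_lt_add_one (rpow_nonneg hx0.le e)).le
    linarith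
  have hra := ceil_le a ha
  have hrb := ceil_le b hb
  have hxa := one_le_rpow hx ha
  have e1 : (2 * (⌈x ^ a⌉₊ : ℝ) + 1) ^ d ≤ 5 ^ d * x ^ (a * d) := by
    rw [rpow_mul hx0.le, rpow_natCast, ← mul_pow]
    exact pow_le_pow_left₀ (by positivity) (by linarith) d
  have e2 : (d : ℝ) * ⌈x ^ b⌉₊ * (2 * ⌈x ^ a⌉₊ + 1) ^ d + 1 ≤
      (d * 2 * 5 ^ d + 1) * x ^ (b + a * d) := by
    have h1 : (d : ℝ) * ⌈x ^ b⌉₊ * (2 * ⌈x ^ a⌉₊ + 1) ^ d ≤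
        d * (2 * x ^ b) * (5 ^ d * x ^ (a * d)) := by gcongr
    have h2 : x ^ (b + a * d) = x ^ b * x ^ (a * d) := rpow_add hx0 _ _
    have h3 : 1 ≤ x ^ (b + a * d) := one_le_rpow hx (by positivity)
    rw [h2] at h3 ⊢
    nlinarith
  have e3 : (2 : ℝ) ^ subdivisions γ x * (d * ⌈x ^ b⌉₊ * (2 * ⌈x ^ a⌉₊ + 1) ^ d + 1) ≤
      2 * (d * 2 * 5 ^ d + 1) * x ^ (κ + b + a * d) := by
    calc _ ≤ (2 * x ^ κ) * ((d * 2 * 5 ^ d + 1) * x ^ (b + a * d)) :=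
          mul_le_mul (two_pow_subdivisions_le h0 h1 hx) e2 (by positivity) (by positivity)
      _ = 2 * (d * 2 * 5 ^ d + 1) * (x ^ κ * x ^ (b + a * d)) := by ring
      _ = _ := by rw [← rpow_add hx0, add_assoc κ b]
  have e4 : x ^ a ≤ x ^ (κ + b + a * d + a) :=
    rpow_le_rpow_of_exponent_le hx (by nlinarith [mul_nonneg ha (Nat.cast_nonneg (α := ℝ) d)])
  have e5 : x ^ (κ + b + a * d) ≤ x ^ (κ + b + a * d + a) :=
    rpow_le_rpow_of_exponent_le hx (by linarith)
  rw [rpow_add hx0 _ 1, rpow_one]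
  have hA : (0 : ℝ) ≤ 2 * (d * 2 * 5 ^ d + 1) := by positivity
  have hp : 0 ≤ x ^ (κ + b + a * d + a) := rpow_nonneg hx0.le _
  calc _ ≤ 2 * (2 * x ^ (κ + b + a * d + a)) +
        2 * (d * 2 * 5 ^ d + 1) * x ^ (κ + b + a * d + a) :=
        add_le_add (by linarith) (e3.trans (mul_le_mul_of_nonneg_left e5 hA))
    _ = x ^ (κ + b + a * d + a) * (4 + 2 * (d * 2 * 5 ^ d + 1)) := by ring
    _ ≤ _ := mul_le_mul_of_nonneg_left hxA hp

/-- The power `max C 1 + 1` exceeds both 1 and C, so it dominates the polynomial factors e^{Bx} as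
well as the target exponent. -/
lemma eventually_mul_exp_le {A B C c : ℝ} (hA : 0 < A) (hB : 0 ≤ B) (hC : 0 < C) (hc : 0 < c) :
    ∀ᶠ x : ℝ in atTop,
      A * exp (B * x - c * x ^ (max C 1 + 1)) ≤ C * exp (-C * x ^ C) := by
  filter_upwards [eventually_ge_atTop 1,
    eventually_ge_atTop ((|log (A / C)| + B + C) / c)] with x hx hxc
  have hx0 : 0 < x := by linarith
  rw [div_le_iff₀ hc] at hxc
  set m := max C 1 with hm
  have h1 : 1 ≤ x ^ m := one_le_rpow hx (hC.le.trans (le_max_left _ _))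
  have h2 : x ≤ x ^ m := by
    simpa using rpow_le_rpow_of_exponent_le hx (le_max_right C 1)
  have h3 : x ^ C ≤ x ^ m := rpow_le_rpow_of_exponent_le hx (le_max_left C 1)
  have h4 : x ^ (m + 1) = x ^ m * x := by rw [rpow_add hx0, rpow_one]
  have h5 : log (A / C) + B * x + C * x ^ C ≤ c * x ^ (m + 1) := by
    have i1 : log (A / C) ≤ |log (A / C)| * x ^ m :=
      (le_abs_self _).trans (le_mul_of_one_le_right (abs_nonneg _) h1)
    have i2 := mul_le_mul_of_nonneg_left h2 hB
    have i3 := mul_le_mul_of_nonneg_left h3 hC.le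
    have i4 := mul_le_mul_of_nonneg_right hxc (by linarith : 0 ≤ x ^ m)
    rw [h4]
    nlinarith
  have h6 : A = C * exp (log (A / C)) := by
    rw [exp_log (by positivity)]; field_simp
  rw [h6, mul_assoc, ← exp_add]
  refine mul_le_mul_of_nonneg_left (exp_le_exp.2 (by linarith)) hC.le

lemma eventually_two_mul_ceil_le_exp (a : ℝ) (ha : 0 ≤ a) :
    ∀ᶠ x : ℝ in atTop, 2 * (⌈x ^ a⌉₊ : ℝ) ≤ exp x := by
  filter_upwards [eventually_ge_atTop 1,
    (tendsto_exp_div_rpow_atTop a).eventually_ge_atTop 4] with x hx h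
  have hx0 : 0 < x := by linarith
  rw [le_div_iff₀ (rpow_pos_of_pos hx0 a)] at h
  have h1 := one_le_rpow hx ha
  have h2 := (Nat.ceil_lt_add_one (rpow_nonneg hx0.le a)).le
  linarith

lemma exists_forall_two_mul_rpow_lt {γ : ℝ} (h1 : γ < 1) :
    ∃ R₁ : ℕ, ∀ R : ℕ, R₁ ≤ R → 2 * (R : ℝ) ^ γ < R := by
  have h : Tendsto (fun R : ℕ => (R : ℝ) ^ (1 - γ)) atTop atTop :=
    (tendsto_rpow_atTop (by linarith)).comp tendsto_natCast_atTop_atTop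
  obtain ⟨R₁, hR₁⟩ := eventually_atTop.1 ((h.eventually_gt_atTop 2).and (eventually_gt_atTop 0))
  refine ⟨R₁, fun R hR => ?_⟩
  obtain ⟨h2, h3⟩ := hR₁ R hR
  have hR0 : (0 : ℝ) < R := by exact_mod_cast h3
  calc 2 * (R : ℝ) ^ γ < (R : ℝ) ^ (1 - γ) * (R : ℝ) ^ γ :=
        mul_lt_mul_of_pos_right h2 (rpow_pos_of_pos hR0 _)
    _ = R := by rw [← rpow_add hR0]; simp

end Scales

end RCM

/-! ### Choice of the scales and union bound -/

theorem mainTheorem2 (d : ℕ) (s β : ℝ) (hds : (d : ℝ) < s) (hs2d : s < 2 * (d : ℝ))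
    (hβ : 0 < β) :
    ∀ C : ℝ, 0 < C → ∃ δ : ℝ, 1 < δ ∧ ∀ ρ : ℝ, 0 < ρ → ∃ N₀ : ℕ, ∀ N : ℕ, N₀ ≤ N →
      ∀ (X : ℕ → Fin d → ℤ), RCM.IsBackbone d N X →
      ∀ (Ω : Type*) [MeasurableSpace Ω] (P : Measure Ω) [IsProbabilityMeasure P]
        (K : Ω → ℕ) (Y : ℕ → Ω → Fin d → ℝ) (U : Sym2 ℕ → Ω → ℝ),
        RCM.IsModel d N P ρ K Y U →
        P {ω | ENNReal.ofReal (Real.log N ^ δ) <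
            ((RCM.clusterDiam
              (RCM.graph d N β s X (K ω) (fun i => Y i ω) (fun e => U e ω)) 0 : ℕ∞) : ℝ≥0∞)}
          ≤ ENNReal.ofReal (C * Real.exp (-C * Real.log N ^ C)) := by
  intro C hC
  have hd : 0 < d := by
    rcases Nat.eq_zero_or_pos d with rfl | h
    · norm_num at hds hs2d; linarith
    · exact h
  have hdR : (0 : ℝ) < d := by exact_mod_cast hd
  have hs : 0 < s := hdR.trans hds
  -- The midpoint of s/(2d) and 1, so that γ < 1 and ε = 2dγ - s > 0.
  set γ : ℝ := (s + 2 * d) / (4 * d) with hγdef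
  have hγ0 : 0 < γ := by positivity
  have hγ1 : γ < 1 := by rw [hγdef, div_lt_one (by positivity)]; linarith
  set ε : ℝ := 2 * d * γ - s with hεdef
  have hε : 0 < ε := by
    have : ε = (2 * d - s) / 2 := by rw [hεdef, hγdef]; field_simp; ring
    rw [this]; linarith
  set a : ℝ := max C 1 + 1 with hadef
  have ha : 0 ≤ a := by have := le_max_right C 1; linarith
  -- Makes R₀^ε at least x^a, so the long-edge estimate decays like the other two.
  set b : ℝ := a / ε with hbdef
  have hb0 : 0 < b := div_pos (by have := le_max_right C 1; linarith) hε
  have hb : 0 ≤ b := hb0.le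
  set c₂ : ℝ := β * (2 * d) ^ (-s) with hc₂
  set c₃ : ℝ := β * (d : ℝ) ^ (-s) with hc₃
  set c : ℝ := min β (min c₂ c₃) with hcdef
  have hc : 0 < c := lt_min hβ (lt_min (by positivity) (by positivity))
  have hκ : 0 ≤ Real.log 2 / -Real.log γ :=
    div_nonneg (Real.log_nonneg (by norm_num)) (by linarith [Real.log_neg hγ0 hγ1])
  refine ⟨Real.log 2 / -Real.log γ + b + a * d + a + 1, by
    have : 0 ≤ a * d := by positivity
    linarith, ?_⟩
  set δ : ℝ := Real.log 2 / -Real.log γ + b + a * d + a + 1 with hδ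
  intro ρ hρ
  obtain ⟨R₁, hR₁⟩ := RCM.exists_forall_two_mul_rpow_lt hγ1
  have hev := (RCM.eventually_scales_le d ha hb hγ0 hγ1).and
    ((RCM.eventually_mul_exp_le (A := 2 + ρ) (B := 4 * d) (by positivity) (by positivity)
      hC hc).and
    ((RCM.eventually_two_mul_ceil_le_exp a ha).and
    -- R₀ has to exceed e, where the subdivisions stop, and R₁, beyond which the boxes are disjoint.
    (((tendsto_rpow_atTop hb0).eventually_ge_atTop (max 3 R₁ : ℝ)).and
      (Filter.eventually_ge_atTop (1 : ℝ)))))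
  have hlog : Filter.Tendsto (fun N : ℕ => Real.log N) Filter.atTop Filter.atTop :=
    Real.tendsto_log_atTop.comp tendsto_natCast_atTop_atTop
  obtain ⟨N₀, hN₀⟩ := Filter.eventually_atTop.1 ((hlog.eventually hev).and
    (Filter.eventually_ge_atTop 2))
  refine ⟨N₀, fun N hN X hX Ω _ P _ K Y U hM => ?_⟩
  obtain ⟨⟨hscale, hexp, hrN, hR0, hx1⟩, hN2⟩ := hN₀ N hN
  set x := Real.log N with hx
  have hNpos : (0 : ℝ) < N := by exact_mod_cast (by omega : 0 < N)
  have hexpx : Real.exp x = N := Real.exp_log hNpos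
  have hx0 : 0 < x := by linarith
  set r := ⌈x ^ a⌉₊ with hr
  set R₀ := ⌈x ^ b⌉₊ with hR₀
  have hra : x ^ a ≤ r := Nat.le_ceil _
  have hrpos : 0 < r := Nat.ceil_pos.2 (Real.rpow_pos_of_pos hx0 a)
  have hrN' : 2 * r ≤ N := by
    rw [hexpx] at hrN
    exact_mod_cast hrN
  have hR₀b : x ^ b ≤ R₀ := Nat.le_ceil _
  have hR₀3 : (3 : ℝ) ≤ R₀ := (le_max_left _ _).trans (hR0.trans hR₀b)
  have hR₀1 : R₁ ≤ R₀ := by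
    have : (R₁ : ℝ) ≤ R₀ := (le_max_right _ _).trans (hR0.trans hR₀b)
    exact_mod_cast this
  set k := RCM.subdivisions γ x with hk
  set M := 2 ^ k * (d * R₀ * (2 * r + 1) ^ d + 1) with hMdef
  have hA := hX.measure_exists_far_neighbours_le (s := s) hd hβ hM.marks hrpos hrN' K Y
  have hB := hX.measure_exists_no_long_edge_le hd hβ hs hM.marks K Y hε.le
    (fun R hR => hR₁ R (hR₀1.trans hR))
  have hD := hX.measure_exists_far_from_backbone_le hd (by omega) hβ hs hρ hM r
  refine (measure_mono ?_).trans ((measure_union_le _ _).trans ((add_le_add (measure_union_le _ _)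
    le_rfl).trans ((add_le_add (add_le_add hA hB) hD).trans ?_)))
  · intro ω hω
    by_contra hnot
    simp only [Set.mem_union, not_or] at hnot
    obtain ⟨⟨hnA, hnB⟩, hnD⟩ := hnot
    rw [Set.mem_ofPred_eq] at hω
    refine (lt_irrefl _ (lt_of_lt_of_le hω ?_))
    have hdiam : RCM.clusterDiam
        (RCM.graph d N β s X (K ω) (fun i => Y i ω) (fun e => U e ω)) 0 ≤ (2 * r + M : ℕ) := by
      refine RCM.clusterDiam_graph_le ?_ ?_
      · intro i hi j hj
        refine le_trans le_self_add (hX.edist_add_one_le (R₀ := R₀) (D := (2 * r + 1) ^ d) (k := k)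
          hγ0.le ?_ ?_ hi hj ?_)
        · intro i hi j hj hij
          by_contra hlt
          exact hnA ⟨i, hi, j, hj, hij, not_le.1 hlt⟩
        · intro i hi j hj hij
          by_contra h
          exact hnB ⟨i, hi, j, hj, hij, h⟩
        · have hle : (RCM.supDist (X i) (X j) : ℝ) ≤ N := by
            have : RCM.supDist (X i) (X j) ≤ N := RCM.supDist_le_iff.2 fun l => by
              have := RCM.mem_latticeCube.1 (hX.mem_cube hi) l
              have := RCM.mem_latticeCube.1 (hX.mem_cube hj) l
              omega
            exact_mod_cast this
          -- By the choice of k, the scale N = e^x shrinks to at most e, which is below R₀.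
          calc (RCM.supDist (X i) (X j) : ℝ) ^ (γ ^ k) ≤ (N : ℝ) ^ (γ ^ k) :=
                Real.rpow_le_rpow (by positivity) hle (by positivity)
            _ = Real.exp (γ ^ k * x) := by
                rw [← hexpx, ← Real.exp_mul, mul_comm]
            _ ≤ Real.exp 1 := Real.exp_le_exp.2 (RCM.pow_subdivisions_mul_le hγ0 hγ1 hx1)
            _ < 3 := Real.exp_one_lt_d9.trans (by norm_num)
            _ ≤ R₀ := hR₀3
      · intro j hj hjK hreach
        by_contra h
        push Not at h
        exact hnD ⟨j, hj, hjK, hreach, fun i hi => not_le.2 (h i hi)⟩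
    calc ((RCM.clusterDiam (RCM.graph d N β s X (K ω) (fun i => Y i ω) (fun e => U e ω)) 0 : ℕ∞) :
          ℝ≥0∞) ≤ (((2 * r + M : ℕ) : ℕ∞) : ℝ≥0∞) := ENat.toENNReal_le.2 hdiam
      _ = ENNReal.ofReal ((2 * r + M : ℕ) : ℝ) := by
          rw [ENat.toENNReal_coe, ENNReal.ofReal_natCast]
      _ ≤ ENNReal.ofReal (x ^ δ) := by
          refine ENNReal.ofReal_le_ofReal ?_
          rw [hMdef]
          push_cast
          exact hscale
  · rw [← ENNReal.ofReal_add (by positivity) (by positivity),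
      ← ENNReal.ofReal_add (by positivity) (by positivity)]
    refine ENNReal.ofReal_le_ofReal (le_trans ?_ hexp)
    have hxa : 0 ≤ x ^ a := Real.rpow_nonneg hx0.le a
    have hN1 : (N : ℝ) + 1 ≤ Real.exp (2 * x) := by
      rw [two_mul, Real.exp_add, hexpx]
      have : (2 : ℝ) ≤ N := by exact_mod_cast hN2
      nlinarith
    have hpow : ∀ y : ℝ, 0 ≤ y → y ≤ Real.exp (2 * x) → y ^ d ≤ Real.exp (2 * d * x) := by
      intro y hy0 hy
      refine (pow_le_pow_left₀ hy0 hy d).trans (le_of_eq ?_)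
      rw [← Real.exp_nat_mul]; ring_nf
    have hpow1 := hpow (N + 1) (by positivity) hN1
    have hpow2 := hpow (2 * r + 1) (by positivity) (le_trans (by
      have : (2 * r : ℝ) ≤ N := by exact_mod_cast hrN'
      linarith) hN1)
    have hpow3 := hpow N hNpos.le (by linarith)
    have hmul : Real.exp (2 * d * x) * Real.exp (2 * d * x) = Real.exp (4 * d * x) := by
      rw [← Real.exp_add]; ring_nf
    have hle1 : Real.exp (2 * d * x) ≤ Real.exp (4 * d * x) :=
      Real.exp_le_exp.2 (by nlinarith [mul_pos hdR hx0])
    have hc1 : c * x ^ a ≤ β * r :=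
      mul_le_mul (min_le_left _ _) hra hxa hβ.le
    have hc2' : c * x ^ a ≤ c₂ * (R₀ : ℝ) ^ ε := by
      refine mul_le_mul ((min_le_right _ _).trans (min_le_left _ _)) ?_ hxa (by positivity)
      calc x ^ a = (x ^ b) ^ ε := by
            rw [← Real.rpow_mul hx0.le, hbdef, div_mul_cancel₀ _ hε.ne']
        _ ≤ _ := Real.rpow_le_rpow (Real.rpow_nonneg hx0.le b) hR₀b hε.le
    have hc3' : c * x ^ a ≤ c₃ * r :=
      mul_le_mul ((min_le_right _ _).trans (min_le_right _ _)) hra hxa (by positivity)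
    have t1 : ((N : ℝ) + 1) ^ d * ((2 * r + 1) ^ d * Real.exp (-β) ^ r) ≤
        Real.exp (4 * d * x - c * x ^ a) := by
      rw [← Real.exp_nat_mul, ← mul_assoc, sub_eq_add_neg, Real.exp_add, ← hmul]
      exact mul_le_mul (mul_le_mul hpow1 hpow2 (by positivity) (by positivity))
        (Real.exp_le_exp.2 (by linarith)) (by positivity) (by positivity)
    have t2 : ((N : ℝ) + 1) ^ d * (N + 1) ^ d * Real.exp (-(c₂ * (R₀ : ℝ) ^ ε)) ≤
        Real.exp (4 * d * x - c * x ^ a) := by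
      rw [sub_eq_add_neg, Real.exp_add, ← hmul]
      exact mul_le_mul (mul_le_mul hpow1 hpow1 (by positivity) (by positivity))
        (Real.exp_le_exp.2 (by linarith)) (by positivity) (by positivity)
    have t3 : ρ * (N : ℝ) ^ d * Real.exp (-β * (d : ℝ) ^ (-s)) ^ r ≤
        ρ * Real.exp (4 * d * x - c * x ^ a) := by
      rw [← Real.exp_nat_mul, mul_assoc, sub_eq_add_neg, Real.exp_add]
      refine mul_le_mul_of_nonneg_left (mul_le_mul (hpow3.trans hle1)
        (Real.exp_le_exp.2 ?_) (by positivity) (by positivity)) hρ.le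
      have : (r : ℝ) * (-β * (d : ℝ) ^ (-s)) = -(c₃ * r) := by rw [hc₃]; ring
      linarith
    linarith
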